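/- Let $k\ge 1$ and let $G=(V,E)$ be the $(k+1)$-regular tree (every node has $k+1$ neighbours). For $\phi\in\{0,1\}^V$ write $I_\phi=\{u\in V:\phi(u)=1\}$. Let $\lambda>0$. A probability measure $\nu$ on $\{0,1\}^V$ (with the product $\sigma$-algebra) is a Gibbs measure for the hard-core model on $G$ with activity $\lambda$ if, for every $u\in V$ and $\nu$-almost all $\phi_0$, $$\nu\big(\phi(u)=1 \,\big|\, \phi(v)=\phi_0(v)\text{ for all }v\ne u\big)=\frac{\lambda}{1+\lambda}\,\mathbf 1\{I_{\phi_0}\cup\{u\}\text{ is an independent set of }G\}.$$ The measure $\nu$ is simple if, for every $u\in V$, the restrictions of $\phi$ to the connected components of $G\setminus\{u\}$ are mutually independent given $\phi(u)$; it is invariant if it is preserved by every automorphism of $G$. A Gibbs measure is extremal if it is an extreme point of the convex set of all Gibbs measures for the same $\lambda$, i.e. it is not a proper mixture of other Gibbs measures. Then, for every $k\ge 1$ and every $0<\lambda\le e-1$, there is exactly one simple invariant Gibbs measure for the hard-core model on $G$ with activity $\lambda$, and it is extremal. In particular, this holds for $\lambda=1$. -/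

import Mathlib

open MeasureTheory ProbabilityTheory
open scoped ENNReal

namespace HardCore

/-- The subset `I_φ = {u : φ(u) = 1}` of the nodes that corresponds to a configuration
`φ ∈ {0,1}^V`; the value `1` is `true`, the value `0` is `false`. -/
def occupied {V : Type*} (φ : V → Bool) : Set V := {u | φ u = true}

/-- `ν` is a Gibbs measure for the hard-core model on the graph `G` with activity `lam`:
a probability measure on `{0,1}^V` such that for every node `u` and `ν`-almost all `φ₀`,
`ν(φ(u) = 1 | φ(v) = φ₀(v) for all v ≠ u) = lam / (1 + lam) · 1{I_{φ₀} ∪ {u} is independent}`.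
The conditional probability is given the σ-algebra generated by the values off `u`. -/
structure IsGibbs {V : Type*} (G : SimpleGraph V) (lam : ℝ) (ν : Measure (V → Bool)) : Prop where
  isProbabilityMeasure : IsProbabilityMeasure ν
  condProb_eq : ∀ u : V,
    ν⟦{φ : V → Bool | φ u = true} | cylinderEvents (X := fun _ : V => Bool) {u}ᶜ⟧ =ᵐ[ν]
      {φ₀ : V → Bool | G.IsIndepSet (occupied φ₀ ∪ {u})}.indicator (fun _ => lam / (1 + lam))

/-- `ν` is simple: for every node `u`, the configurations on the connected components of `G ∖ {u}`
are mutually independent given `φ(u)`. Since `φ(u)` takes two values only, this is independence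
under `ν` conditioned on each event `{φ(u) = a}` of positive probability. -/
def IsSimple {V : Type*} (G : SimpleGraph V) (ν : Measure (V → Bool)) : Prop :=
  ∀ (u : V) (a : Bool), ν {φ | φ u = a} ≠ 0 →
    iIndep (fun C : G.ComponentCompl {u} => cylinderEvents (X := fun _ : V => Bool) C.supp)
      (ν[|{φ | φ u = a}])

/-- `ν` is invariant: it is preserved by every automorphism of the graph `G`. -/
def IsInvariant {V : Type*} (G : SimpleGraph V) (ν : Measure (V → Bool)) : Prop :=
  ∀ e : G ≃g G, ν.map (fun φ v => φ (e v)) = ν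

/-- `ν` is a simple invariant Gibbs measure for the hard-core model. -/
structure IsSimpleInvariantGibbs {V : Type*} (G : SimpleGraph V) (lam : ℝ)
    (ν : Measure (V → Bool)) : Prop where
  isGibbs : IsGibbs G lam ν
  isSimple : IsSimple G ν
  isInvariant : IsInvariant G ν

/-- `ν` is an extremal Gibbs measure: an extreme point of the convex set of Gibbs measures, that is,
a Gibbs measure that is no proper mixture of other Gibbs measures. -/
def IsExtremalGibbs {V : Type*} (G : SimpleGraph V) (lam : ℝ) (ν : Measure (V → Bool)) : Prop :=
  ν ∈ Set.extremePoints ℝ≥0∞ {ν' : Measure (V → Bool) | IsGibbs G lam ν'}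

end HardCore

/-! A simple measure on a tree is a Markov chain indexed by the tree. If it is hard-core and each
vertex is vacant with the same probability π₀, then, given that u is vacant and given all values on
the far side of u, a neighbour w of u is vacant with probability q = 2 - 1/π₀ (`IsChain`). For an
invariant Gibbs measure the Gibbs condition at one vertex reads 1 - π₀ = λ q^(k+1) π₀, so p = 1 - q
solves p = λ(1 - p)^(k+1). The two sides are monotone in opposite directions, hence p is unique.
Since q determines the law of the chain (`IsChain.eq`), there is at most one such measure.
Conversely, the chain built outwards from a root by independent trials is simple; it is Gibbs by
`IsSimple.isGibbs` and invariant because its law is determined by q. All this works for every λ > 0.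

Extremality is where λ ≤ e - 1 enters. If μ = aν + bν' with ν, ν' Gibbs, then ν ≤ a⁻¹μ. Let Q_n be
the probability that w is vacant, computed from the values at depth n in its branch when u is vacant
(`posterior`). The same function serves all Gibbs measures. If Q_n tends to q in L²(μ) on the event
that u is vacant, it does so in L²(ν), so ν is a chain with the same q and equals μ
(`IsGibbs.isChain_of_le`).

The convergence under μ is a second moment bound. The moment of Q_n² with u vacant is q times the
moment of Q_n with w vacant. Given w occupied, its children are vacant and their branches
independent, so convexity of 1/(1 + R) bounds the mean of Q_n given w vacant by S_n, where S_0 = 1,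
S_(n+1) = 1 - x/(1 + λ S_n^k) and x = p/q. These iterates decrease to a fixed point, and
`mul_one_sub_div_pow_lt` shows that q = 1/(1 + x) is the only fixed point in [q, 1] when λ ≤ e - 1.
-/

namespace HardCore

/-! ### Branches, parents and recursion on trees -/

section Tree

variable {V : Type*} {G : SimpleGraph V}

/-- The vertices that are closer to `w` than to `u`. For adjacent vertices `u`, `w` of a tree this
is the connected component of `w` in the tree with `u` removed. -/
def branch (G : SimpleGraph V) (u w : V) : Set V := {z | G.dist z w < G.dist z u}

lemma mem_branch {u w z : V} : z ∈ branch G u w ↔ G.dist z w < G.dist z u := Iff.rfl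

lemma notMem_branch_left (u w : V) : u ∉ branch G u w := by simp [mem_branch]

lemma mem_branch_right {u w : V} (h : G.Adj u w) : w ∈ branch G u w := by
  simp [mem_branch, SimpleGraph.dist_eq_one_iff_adj.mpr h.symm]

lemma ne_of_mem_branch {u w z : V} (h : z ∈ branch G u w) : z ≠ u := by
  rintro rfl
  exact notMem_branch_left _ _ h

lemma dist_eq_of_mem_branch (hG : G.IsTree) {u w z : V} (h : G.Adj u w) (hz : z ∈ branch G u w) :
    G.dist z u = G.dist z w + 1 := by
  rw [mem_branch] at hz
  have := hG.dist_eq_dist_add_one_of_adj z h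
  omega

/-- Prefixing `w` to a geodesic from `z` or `z'` to `x` gives a path from `w` to `x`, and a tree has
only one such path. -/
lemma eq_of_mem_branch (hG : G.IsTree) {w z z' x : V} (h : G.Adj w z) (h' : G.Adj w z')
    (hx : x ∈ branch G w z) (hx' : x ∈ branch G w z') : z = z' := by
  have key : ∀ y (hy : G.Adj w y), x ∈ branch G w y →
      ∃ p : G.Walk y x, (SimpleGraph.Walk.cons hy p).IsPath := by
    intro y hy hxy
    obtain ⟨p, -, hp⟩ := hG.connected.exists_path_of_dist y x
    refine ⟨p, SimpleGraph.Walk.isPath_of_length_eq_dist _ ?_⟩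
    rw [SimpleGraph.Walk.length_cons, hp, G.dist_comm, G.dist_comm (u := w),
      dist_eq_of_mem_branch hG hy hxy]
  obtain ⟨p, hp⟩ := key z h hx
  obtain ⟨p', hp'⟩ := key z' h' hx'
  have := (hG.isAcyclic.subsingleton_path _ _).elim ⟨_, hp⟩ ⟨_, hp'⟩
  have := congrArg (fun q => q.1.snd) this
  simpa using this

lemma disjoint_branch (hG : G.IsTree) {w z z' : V} (h : G.Adj w z) (h' : G.Adj w z')
    (hne : z ≠ z') : Disjoint (branch G w z) (branch G w z') :=
  Set.disjoint_left.mpr fun _ hx hx' => hne (eq_of_mem_branch hG h h' hx hx')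

lemma exists_mem_branch (hG : G.IsTree) {w x : V} (hne : x ≠ w) :
    ∃ z, G.Adj w z ∧ x ∈ branch G w z := by
  obtain ⟨p, hp⟩ := hG.connected.exists_walk_length_eq_dist w x
  cases p with
  | nil => exact absurd rfl hne
  | cons h q =>
    refine ⟨_, h, ?_⟩
    rw [SimpleGraph.Walk.length_cons] at hp
    have := SimpleGraph.dist_le q
    rw [mem_branch, G.dist_comm, G.dist_comm (u := x)]
    omega

lemma compl_branch (hG : G.IsTree) {u w : V} (h : G.Adj u w) :
    (branch G u w)ᶜ = branch G w u := by
  ext z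
  have := hG.dist_eq_dist_add_one_of_adj z h
  simp only [Set.mem_compl_iff, mem_branch]
  omega

lemma branch_subset_branch (hG : G.IsTree) {u w z : V} (h : G.Adj u w) (hz : G.Adj w z)
    (hne : z ≠ u) : branch G w z ⊆ branch G u w := by
  intro x hx
  by_contra hx'
  have : x ∈ branch G w u := by rw [← compl_branch hG h]; exact hx'
  exact hne (eq_of_mem_branch hG hz h.symm hx this)

/-- The edge from `u` to `w` is the only one that leaves the branch. If `y` is farther from `u` than
`x`, the triangle inequality suffices; if it is nearer, it is the neighbour of `x` towards `u`,
which is also the one towards `w` unless `x = w`. -/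
lemma mem_branch_of_adj (hG : G.IsTree) {u w x y : V} (h : G.Adj u w) (hxy : G.Adj x y)
    (hy : y ≠ u) (hx : x ∈ branch G u w) : y ∈ branch G u w := by
  have hxd := dist_eq_of_mem_branch hG h hx
  have tri := hG.connected.dist_triangle (u := y) (v := x) (w := w)
  have h1 : G.dist y x = 1 := SimpleGraph.dist_eq_one_iff_adj.mpr hxy.symm
  have h2 := hG.dist_eq_dist_add_one_of_adj u hxy
  rw [G.dist_comm, G.dist_comm (u := u)] at h2
  rcases h2 with h2 | h2
  · have hxw : x ≠ w := by
      rintro rfl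
      rw [SimpleGraph.dist_self] at hxd
      have : G.dist y u = 0 := by omega
      exact hy (hG.connected.dist_eq_zero_iff.mp this)
    obtain ⟨z, hz, hwz⟩ := exists_mem_branch hG hxw.symm
    have hwz' := dist_eq_of_mem_branch hG hz hwz
    have tri2 := hG.connected.dist_triangle (u := z) (v := w) (w := u)
    have h3 : G.dist w u = 1 := SimpleGraph.dist_eq_one_iff_adj.mpr h.symm
    rw [G.dist_comm, G.dist_comm (u := w) (v := z)] at hwz'
    have hzy : z = y := by
      refine eq_of_mem_branch hG (x := u) hz hxy ?_ ?_ <;>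
      · rw [mem_branch, G.dist_comm, G.dist_comm (u := u) (v := x)]
        omega
    subst hzy
    rw [mem_branch]; omega
  · rw [mem_branch]; omega

lemma componentComplMk_eq_of_mem_branch (hG : G.IsTree) {u w : V} (h : G.Adj u w) :
    ∀ (z : V) (hz : z ∈ branch G u w),
      G.componentComplMk (K := {u}) (show z ∉ ({u} : Set V) from ne_of_mem_branch hz) =
        G.componentComplMk (K := {u}) (show w ∉ ({u} : Set V) from h.ne') := by
  suffices H : ∀ (n : ℕ) (z : V) (hz : z ∈ branch G u w), G.dist z w = n →
      G.componentComplMk (K := {u}) (show z ∉ ({u} : Set V) from ne_of_mem_branch hz) =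
        G.componentComplMk (K := {u}) (show w ∉ ({u} : Set V) from h.ne') from
    fun z hz => H _ z hz rfl
  intro n
  induction n with
  | zero =>
    intro z hz h0
    obtain rfl := hG.connected.dist_eq_zero_iff.mp h0
    rfl
  | succ n ih =>
    intro z hz hn
    have hzw : w ≠ z := by
      rintro rfl
      simp at hn
    obtain ⟨y, hy, hwy⟩ := exists_mem_branch hG hzw
    have hd := dist_eq_of_mem_branch hG hy hwy
    rw [G.dist_comm, G.dist_comm (u := w) (v := y)] at hd
    have hyu : y ≠ u := by
      rintro rfl
      have h3 : G.dist y w = 1 := SimpleGraph.dist_eq_one_iff_adj.mpr h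
      have h4 : G.dist z y = 1 := SimpleGraph.dist_eq_one_iff_adj.mpr hy
      rw [mem_branch] at hz
      omega
    have hyb := mem_branch_of_adj hG h hy hyu hz
    rw [← ih y hyb (by omega)]
    exact SimpleGraph.componentComplMk_eq_of_adj G _ _ hy

/-- This links the metric branches to the components in `IsSimple`: no edge avoiding `u` leaves the
branch, and stepping towards `w` stays in it. -/
lemma supp_componentComplMk (hG : G.IsTree) {u w : V} (h : G.Adj u w) :
    (G.componentComplMk (K := {u}) (show w ∉ ({u} : Set V) from h.ne')).supp = branch G u w := by
  ext z
  constructor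
  · rintro ⟨hz, hzw⟩
    let f : G.ComponentCompl {u} → Prop := SimpleGraph.ComponentCompl.lift
      (fun v _ => v ∈ branch G u w) (fun v v' hv hv' a => propext
        ⟨mem_branch_of_adj hG h a hv', mem_branch_of_adj hG h a.symm hv⟩)
    have : f (G.componentComplMk hz) = f (G.componentComplMk (K := {u}) (v := w) h.ne') :=
      congrArg f hzw
    exact this.mpr (mem_branch_right h)
  · intro hz
    exact ⟨ne_of_mem_branch hz, componentComplMk_eq_of_mem_branch hG h z hz⟩

lemma exists_supp_eq_branch (hG : G.IsTree) {u : V} (C : G.ComponentCompl {u}) :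
    ∃ w, G.Adj u w ∧ C.supp = branch G u w := by
  obtain ⟨z, hz⟩ := C.nonempty
  have hzu : z ∉ ({u} : Set V) := SimpleGraph.ComponentCompl.notMem_of_mem hz
  obtain ⟨w, h, hw⟩ := exists_mem_branch hG (w := u) hzu
  refine ⟨w, h, ?_⟩
  rw [← supp_componentComplMk hG h, ← componentComplMk_eq_of_mem_branch hG h z hw]
  obtain ⟨h1, h2⟩ := hz
  rw [← h2]

/-- The neighbour of `v` on the way to the root `o`. -/
noncomputable def parent (G : SimpleGraph V) (o v : V) : V :=
  open Classical in if h : ∃ z, G.Adj v z ∧ o ∈ branch G v z then h.choose else v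

lemma parent_spec (hG : G.IsTree) {o v : V} (h : v ≠ o) :
    G.Adj v (parent G o v) ∧ o ∈ branch G v (parent G o v) := by
  have := exists_mem_branch hG h.symm
  rw [parent, dif_pos this]
  exact this.choose_spec

lemma parent_eq (hG : G.IsTree) {o v z : V} (h : G.Adj v z) (hz : o ∈ branch G v z) :
    parent G o v = z := by
  have hne : v ≠ o := (ne_of_mem_branch hz).symm
  exact eq_of_mem_branch hG (parent_spec hG hne).1 h (parent_spec hG hne).2 hz

lemma dist_parent (hG : G.IsTree) {o v : V} (h : v ≠ o) :
    G.dist o v = G.dist o (parent G o v) + 1 :=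
  dist_eq_of_mem_branch hG (parent_spec hG h).1 (parent_spec hG h).2

lemma eq_parent_or_eq_parent (hG : G.IsTree) (o : V) {v z : V} (h : G.Adj v z) :
    (v ≠ o ∧ z = parent G o v) ∨ (z ≠ o ∧ v = parent G o z) := by
  by_cases hz : o ∈ branch G v z
  · exact Or.inl ⟨(ne_of_mem_branch hz).symm, (parent_eq hG h hz).symm⟩
  · have : o ∈ branch G z v := by rw [← compl_branch hG h]; exact hz
    exact Or.inr ⟨(ne_of_mem_branch this).symm, (parent_eq hG h.symm this).symm⟩

lemma parent_induction (hG : G.IsTree) (o : V) {P : V → Prop} (h0 : P o)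
    (hs : ∀ v, v ≠ o → P (parent G o v) → P v) (v : V) : P v := by
  suffices H : ∀ n v, G.dist o v = n → P v from H _ v rfl
  intro n
  induction n with
  | zero =>
    intro v hv
    obtain rfl := hG.connected.dist_eq_zero_iff.mp hv
    exact h0
  | succ n ih =>
    intro v hv
    have hne : v ≠ o := by
      rintro rfl
      simp at hv
    have := dist_parent hG hne
    exact hs v hne (ih _ (by omega))

/-- The function on the vertices with value `a` at the root `o` and the value `F v b` at a vertex
`v ≠ o` whose parent has the value `b`. -/
noncomputable def treeRec {α : Type*} (G : SimpleGraph V) (o : V) (a : α) (F : V → α → α) (v : V) :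
    α :=
  aux (G.dist o v) v
where
  /-- The value at a vertex whose distance to the root is given. -/
  aux : ℕ → V → α
  | 0, _ => a
  | n + 1, v => F v (aux n (parent G o v))

lemma treeRec_root {α : Type*} (o : V) (a : α) (F : V → α → α) : treeRec G o a F o = a := by
  simp [treeRec, treeRec.aux]

lemma treeRec_of_ne {α : Type*} (hG : G.IsTree) {o v : V} (a : α) (F : V → α → α) (h : v ≠ o) :
    treeRec G o a F v = F v (treeRec G o a F (parent G o v)) := by
  rw [treeRec, dist_parent hG h, treeRec.aux, treeRec]

lemma countable_of_isTree [G.LocallyFinite] (hG : G.IsTree) : Countable V := by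
  obtain ⟨o⟩ := hG.connected.nonempty
  have hfin : ∀ n : ℕ, {v | G.dist o v = n}.Finite := by
    intro n
    induction n with
    | zero =>
      refine (Set.finite_singleton o).subset fun v hv => ?_
      exact (hG.connected.dist_eq_zero_iff.mp hv).symm
    | succ n ih =>
      refine (ih.biUnion fun v _ => (G.neighborSet v).toFinite).subset fun v hv => ?_
      have hne : v ≠ o := by
        rintro rfl
        simp at hv
      have h1 := dist_parent hG hne
      have h2 : G.dist o v = n + 1 := hv
      exact Set.mem_biUnion (show G.dist o (parent G o v) = n by omega)
        (parent_spec hG hne).1.symm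
  have : (Set.univ : Set V) = ⋃ n : ℕ, {v | G.dist o v = n} := by
    ext v; simp
  rw [← Set.countable_univ_iff, this]
  exact Set.countable_iUnion fun n => (hfin n).countable

lemma dist_iso (e : G ≃g G) (u v : V) : G.dist (e u) (e v) = G.dist u v := by
  have key : ∀ (f : G ≃g G) (u v : V), G.edist (f u) (f v) ≤ G.edist u v := by
    intro f u v
    rw [SimpleGraph.edist_eq_sInf (u := u)]
    refine le_sInf ?_
    rintro _ ⟨p, rfl⟩
    simpa using SimpleGraph.edist_le (p.map f.toHom)
  have h := key e.symm (e u) (e v)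
  simp only [RelIso.symm_apply_apply] at h
  rw [SimpleGraph.dist, SimpleGraph.dist, le_antisymm (key e u v) h]

lemma mem_branch_iso (e : G ≃g G) (u w z : V) :
    e z ∈ branch G (e u) (e w) ↔ z ∈ branch G u w := by
  simp [mem_branch, dist_iso]

end Tree

/-! ### The scalar recursion and its fixed point -/

section Recursion

lemma sub_sq_div_two_le_log {x : ℝ} (hx : 0 ≤ x) : x - x ^ 2 / 2 ≤ Real.log (1 + x) := by
  refine le_trans ?_ (Real.le_log_one_add_of_nonneg hx)
  rw [le_div_iff₀ (by positivity)]
  nlinarith [pow_nonneg hx 3]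

lemma concaveOn_one_add_mul_log {x : ℝ} (hx : 0 < x) :
    ConcaveOn ℝ (Set.Icc x 1) (fun r => (1 + r) * Real.log r) := by
  have hpos : ∀ r ∈ Set.Icc x 1, (0 : ℝ) < r := fun r hr => hx.trans_le hr.1
  have hd : ∀ r, 0 < r →
      HasDerivAt (fun r => (1 + r) * Real.log r) (Real.log r + (r⁻¹ + 1)) r := by
    intro r hr
    have := ((hasDerivAt_id r).const_add 1).mul (Real.hasDerivAt_log hr.ne')
    refine this.congr_deriv ?_
    show 1 * Real.log r + (1 + r) * r⁻¹ = _
    rw [one_mul, add_mul, one_mul, mul_inv_cancel₀ hr.ne']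
  refine concaveOn_of_hasDerivWithinAt2_nonpos (f' := fun r => Real.log r + (r⁻¹ + 1))
    (f'' := fun r => r⁻¹ + -(r ^ 2)⁻¹) (convex_Icc x 1) ?_ ?_ ?_ ?_
  · exact fun r hr => (hd r (hpos r hr)).continuousAt.continuousWithinAt
  · exact fun r hr => (hd r (hpos r (interior_subset hr))).hasDerivWithinAt
  · intro r hr
    have hr0 := hpos r (interior_subset hr)
    exact ((Real.hasDerivAt_log hr0.ne').add
      ((hasDerivAt_inv hr0.ne').add_const 1)).hasDerivWithinAt
  · intro r hr
    have hr0 := hpos r (interior_subset hr)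
    have hr1 : r ≤ 1 := (interior_subset hr).2
    have : r⁻¹ ≤ (r ^ 2)⁻¹ := inv_anti₀ (by positivity) (by nlinarith)
    show r⁻¹ + -(r ^ 2)⁻¹ ≤ 0
    linarith

/-- Logarithmic form of the fixed point inequality, used with `c = k * x`. For `c ≤ 2` the bound
log(r/x) ≥ 2(r - x)/(r + x) is enough. For `c > 2` the hypothesis `hc` gives control at `r = 1` and
at `r = L`; concavity carries the former down to `x`, and a tangent bound for the logarithm carries
the latter down to 1. -/
lemma mul_sub_lt_mul_log {x c r L : ℝ} (hx : 0 < x) (hx1 : x < 1) (hxr : x < r) (hrL : r ≤ L)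
    (hL : L ≤ 1.72) (hc : c * (1 - x / 2) ≤ Real.log L - Real.log x) :
    c * (r - x) < (1 + r) * (Real.log r - Real.log x) := by
  have hr : 0 < r := hx.trans hxr
  have hL0 : 0 < L := hr.trans_le hrL
  have hlogL : Real.log L ≤ L - 1 := Real.log_le_sub_one_of_pos hL0
  rcases le_or_gt c 2 with hc2 | hc2
  · have h1 : 2 * ((r - x) / x) / ((r - x) / x + 2) ≤ Real.log r - Real.log x := by
      rw [← Real.log_div hr.ne' hx.ne']
      convert Real.le_log_one_add_of_nonneg (x := (r - x) / x) (by
        apply div_nonneg <;> linarith) using 2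
      field_simp
      ring
    have h2 : 2 * ((r - x) / x) / ((r - x) / x + 2) = 2 * (r - x) / (r + x) := by
      have : (r - x) / x + 2 = (r + x) / x := by field_simp; ring
      rw [this]
      field_simp
    rw [h2] at h1
    have h3 : 2 * (r - x) < (1 + r) * (2 * (r - x) / (r + x)) := by
      rw [← mul_div_assoc, lt_div_iff₀ (by positivity)]
      nlinarith [mul_pos (sub_pos.mpr hxr) (sub_pos.mpr hx1)]
    nlinarith [mul_le_mul_of_nonneg_left h1 (by positivity : 0 ≤ 1 + r)]
  · rcases le_or_gt r 1 with hr1 | hr1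
    · set t := (r - x) / (1 - x) with ht
      have hx1' : 0 < 1 - x := by linarith
      have ht0 : 0 < t := div_pos (by linarith) hx1'
      have ht1 : t ≤ 1 := by rw [ht, div_le_one hx1']; linarith
      have hrt : t * (1 - x) = r - x := by rw [ht]; field_simp
      have hcv := (concaveOn_one_add_mul_log hx).2 ⟨le_rfl, hx1.le⟩ ⟨hx1.le, le_rfl⟩
        (sub_nonneg.mpr ht1) ht0.le (by ring)
      simp only [smul_eq_mul, Real.log_one, mul_zero, add_zero, mul_one] at hcv
      have hr' : (1 - t) * x + t = r := by linarith
      rw [hr'] at hcv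
      -- Twice `hc` with log L ≤ 0.72 gives -2 log x - c(1 - x) ≥ c - 1.44, positive since `c > 2`.
      have hend : 0 < -2 * Real.log x - c * (1 - x) := by linarith
      have := mul_pos ht0 hend
      have e1 : r = x + t * (1 - x) := by linarith
      have e2 : (1 + r) * Real.log x = (1 + x + t * (1 - x)) * Real.log x := by rw [e1]; ring
      have e3 : c * (r - x) = c * (t * (1 - x)) := by rw [hrt]
      rw [mul_sub (1 + r), e2, e3]
      linarith
    · have h1 : Real.log L - Real.log r ≤ L / r - 1 := by
        rw [← Real.log_div hL0.ne' hr.ne']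
        exact Real.log_le_sub_one_of_pos (by positivity)
      -- After clearing `r` this is L(1 + r) < 4r, true for `r > 1` and `L ≤ 1.72`.
      have h2 : (1 + r) * (L / r - 1) < 3 - r := by
        have : (1 + r) * (L / r - 1) = (1 + r) * (L - r) / r := by field_simp
        rw [this, div_lt_iff₀ hr]
        nlinarith
      -- The right side is what remains of (1 + r) times `hc` after subtracting c(r - x); the bound
      -- uses `c > 2` and `x < 1`.
      have h3 : 3 - r ≤ c * (1 + x * (1 - r) / 2) := by
        nlinarith [mul_nonneg (sub_nonneg.mpr hx1.le) (sub_nonneg.mpr hr1.le)]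
      nlinarith [mul_le_mul_of_nonneg_left h1 (by positivity : 0 ≤ 1 + r),
        mul_le_mul_of_nonneg_left hc (by positivity : 0 ≤ 1 + r)]

/-- Substituting L = x(1 + x)^k rewrites the left side as x(1 + x(r - x)/(1 + r))^k, at most x
exp(kx(r - x)/(1 + r)). It remains to compare the exponent with log(r/x). -/
lemma mul_one_sub_div_pow_lt {k : ℕ} (hk : 1 ≤ k) {x r L : ℝ} (hx : 0 < x)
    (hxL : x * (1 + x) ^ k = L) (hL : L ≤ Real.exp 1 - 1) (hxr : x < r) (hrL : r ≤ L) :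
    L * (1 - x / (1 + r)) ^ k < r := by
  have hr : 0 < r := hx.trans hxr
  -- The bound e - 1 enters only through this numerical consequence.
  have hL' : L ≤ 1.72 := by
    have := Real.exp_one_lt_d9
    linarith
  have hx1 : x < 1 := by
    by_contra! h
    have : 1 + x ≤ (1 + x) ^ k := le_self_pow₀ (by linarith) (by omega)
    nlinarith
  have hlog : Real.log L - Real.log x = k * Real.log (1 + x) := by
    rw [← hxL, Real.log_mul hx.ne' (by positivity), Real.log_pow]
    ring
  have hc : (k * x) * (1 - x / 2) ≤ Real.log L - Real.log x := by
    rw [hlog]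
    have := mul_le_mul_of_nonneg_left (sub_sq_div_two_le_log hx.le) (Nat.cast_nonneg (α := ℝ) k)
    linarith
  have key := mul_sub_lt_mul_log hx hx1 hxr hrL hL' hc
  have e1 : (1 + x) * (1 - x / (1 + r)) = 1 + x * ((r - x) / (1 + r)) := by
    field_simp
    ring
  have e2 : L * (1 - x / (1 + r)) ^ k = x * (1 + x * ((r - x) / (1 + r))) ^ k := by
    rw [← e1, mul_pow, ← hxL]; ring
  have ha : 0 ≤ x * ((r - x) / (1 + r)) :=
    mul_nonneg hx.le (div_nonneg (by linarith) (by linarith))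
  have e3 : (1 + x * ((r - x) / (1 + r))) ^ k ≤ Real.exp (k * (x * ((r - x) / (1 + r)))) := by
    rw [Real.exp_nat_mul]
    refine pow_le_pow_left₀ (by linarith) ?_ k
    linarith [Real.add_one_le_exp (x * ((r - x) / (1 + r)))]
  have e4 : k * (x * ((r - x) / (1 + r))) < Real.log (r / x) := by
    have : k * (x * ((r - x) / (1 + r))) = (k * x) * (r - x) / (1 + r) := by ring
    rw [Real.log_div hr.ne' hx.ne', this, div_lt_iff₀ (by linarith)]
    linarith
  calc L * (1 - x / (1 + r)) ^ k ≤ x * Real.exp (k * (x * ((r - x) / (1 + r)))) := by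
        rw [e2]; exact mul_le_mul_of_nonneg_left e3 hx.le
    _ < x * (r / x) := by
        refine mul_lt_mul_of_pos_left ?_ hx
        rw [← Real.exp_log (div_pos hr hx)]
        exact Real.exp_lt_exp.mpr e4
    _ = r := by field_simp

/-- The iterates, started from `1`, of the upper bound for the second moment of the posterior
probability that a vertex is vacant. -/
noncomputable def momentBound (k : ℕ) (x L : ℝ) : ℕ → ℝ
  | 0 => 1
  | n + 1 => 1 - x / (1 + L * momentBound k x L n ^ k)

/-- The iterated map is increasing, so the iterates started from 1 decrease and stay above its fixed
point 1/(1 + x). For the limit l, the number r = L l^k lies in [x, L] and satisfies r = L(1 - x/(1 +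
r))^k, which forces r = x. -/
lemma tendsto_momentBound {k : ℕ} (hk : 1 ≤ k) {x L : ℝ} (hx : 0 < x)
    (hxL : x * (1 + x) ^ k = L) (hL : L ≤ Real.exp 1 - 1) :
    Filter.Tendsto (momentBound k x L) Filter.atTop (nhds (1 + x)⁻¹) := by
  set S := momentBound k x L with hS
  have hL0 : 0 < L := by rw [← hxL]; positivity
  have hq0 : 0 < (1 + x)⁻¹ := by positivity
  have hLq : L * ((1 + x)⁻¹) ^ k = x := by
    rw [← hxL, mul_assoc, ← mul_pow, mul_inv_cancel₀ (by positivity), one_pow, mul_one]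
  have hfix : 1 - x / (1 + x) = (1 + x)⁻¹ := by field_simp; ring
  have hmono : ∀ s t : ℝ, 0 ≤ s → s ≤ t → 1 - x / (1 + L * s ^ k) ≤ 1 - x / (1 + L * t ^ k) := by
    intro s t hs hst
    have : s ^ k ≤ t ^ k := pow_le_pow_left₀ hs hst k
    gcongr
  have hlow : ∀ n, (1 + x)⁻¹ ≤ S n := by
    intro n
    induction n with
    | zero => exact inv_le_one_of_one_le₀ (by linarith)
    | succ n ih =>
      have := hmono _ _ hq0.le ih
      rwa [hLq, hfix] at this
  have hanti : Antitone S := by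
    refine antitone_nat_of_succ_le fun n => ?_
    induction n with
    | zero =>
      show 1 - x / (1 + L * S 0 ^ k) ≤ 1
      have : 0 ≤ S 0 := hq0.le.trans (hlow 0)
      have : 0 ≤ x / (1 + L * S 0 ^ k) := by positivity
      linarith
    | succ n ih => exact hmono _ _ (hq0.le.trans (hlow _)) ih
  have hlim := tendsto_atTop_ciInf hanti ⟨_, by rintro _ ⟨n, rfl⟩; exact hlow n⟩
  set l := ⨅ n, S n
  have hl0 : (1 + x)⁻¹ ≤ l := le_ciInf hlow
  have hl1 : l ≤ 1 := ciInf_le ⟨_, by rintro _ ⟨n, rfl⟩; exact hlow n⟩ 0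
  have hlpos : 0 < l := hq0.trans_le hl0
  have hne : 1 + L * l ^ k ≠ 0 := by positivity
  have hlfix : l = 1 - x / (1 + L * l ^ k) := by
    refine tendsto_nhds_unique ((Filter.tendsto_add_atTop_iff_nat 1).mpr hlim) ?_
    exact tendsto_const_nhds.sub (tendsto_const_nhds.div
      (tendsto_const_nhds.add (tendsto_const_nhds.mul (hlim.pow k))) hne)
  have hr1 : L * l ^ k ≤ L := by
    have : l ^ k ≤ 1 := pow_le_one₀ hlpos.le hl1
    nlinarith
  have hr2 : x ≤ L * l ^ k := by
    rw [← hLq]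
    exact mul_le_mul_of_nonneg_left (pow_le_pow_left₀ hq0.le hl0 k) hL0.le
  have hrx : L * l ^ k = x := by
    by_contra hne'
    have := mul_one_sub_div_pow_lt hk hx hxL hL (lt_of_le_of_ne hr2 (Ne.symm hne')) hr1
    rw [← hlfix] at this
    exact lt_irrefl _ this
  rw [hrx, hfix] at hlfix
  rwa [hlfix] at hlim

lemma exists_eq_mul_one_sub_pow (k : ℕ) {L : ℝ} (hL : 0 < L) :
    ∃ p : ℝ, 0 < p ∧ p < 1 ∧ p = L * (1 - p) ^ (k + 1) := by
  have hcont : ContinuousOn (fun p : ℝ => p - L * (1 - p) ^ (k + 1)) (Set.Icc 0 1) := by fun_prop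
  have := intermediate_value_Ioo zero_le_one hcont
  have h0 : (0 : ℝ) ∈ Set.Ioo ((0 : ℝ) - L * (1 - 0) ^ (k + 1)) (1 - L * (1 - 1) ^ (k + 1)) := by
    simp [hL]
  obtain ⟨p, hp, hp'⟩ := this h0
  exact ⟨p, hp.1, hp.2, by simpa [sub_eq_zero] using hp'⟩

lemma eq_of_eq_mul_one_sub_pow {k : ℕ} {L p p' : ℝ} (hL : 0 < L) (hp : p ≤ 1) (hp' : p' ≤ 1)
    (h : p = L * (1 - p) ^ (k + 1)) (h' : p' = L * (1 - p') ^ (k + 1)) : p = p' := by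
  have key : ∀ a b : ℝ, b ≤ 1 → a = L * (1 - a) ^ (k + 1) → b = L * (1 - b) ^ (k + 1) →
      ¬ a < b := by
    intro a b hb ha' hb' hab
    have : (1 - b) ^ (k + 1) ≤ (1 - a) ^ (k + 1) := pow_le_pow_left₀ (by linarith) (by linarith) _
    nlinarith
  exact le_antisymm (not_lt.mp (key _ _ hp h' h)) (not_lt.mp (key _ _ hp' h h'))

end Recursion

/-! ### Vertex-transitivity of regular trees -/

section Automorphism

variable {V : Type*} {G : SimpleGraph V}

/-- The neighbours of `v` that lie farther from the root `o` than `v`. -/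
def children (G : SimpleGraph V) (o v : V) : Set V := {z | G.Adj v z ∧ o ∉ branch G v z}

lemma mem_children_parent (hG : G.IsTree) {o v : V} (h : v ≠ o) :
    v ∈ children G o (parent G o v) := by
  obtain ⟨h1, h2⟩ := parent_spec hG h
  refine ⟨h1.symm, ?_⟩
  rw [← compl_branch hG h1.symm] at h2
  exact h2

lemma ne_and_parent_eq_of_mem_children (hG : G.IsTree) {o v z : V} (h : z ∈ children G o v) :
    z ≠ o ∧ parent G o z = v := by
  have : o ∈ branch G z v := by rw [← compl_branch hG h.1]; exact h.2
  exact ⟨(ne_of_mem_branch this).symm, parent_eq hG h.1.symm this⟩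

lemma encard_children [G.LocallyFinite] (hG : G.IsTree) {d : ℕ} (hreg : G.IsRegularOfDegree d)
    (o v : V) : (children G o v).encard = open Classical in if v = o then (d : ℕ∞) else d - 1 := by
  classical
  have hcard : (G.neighborSet v).encard = d := by
    rw [← hreg.degree_eq v, ← SimpleGraph.card_neighborSet_eq_degree, Set.encard_eq_coe_toFinset_card,
      Set.toFinset_card]
  split_ifs with h
  · subst h
    rw [← hcard]
    congr 1
    ext z
    simp only [children, Set.mem_ofPred_eq, SimpleGraph.mem_neighborSet, and_iff_left_iff_imp]
    exact fun _ => notMem_branch_left v z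
  · obtain ⟨h1, h2⟩ := parent_spec hG h
    have : children G o v = G.neighborSet v \ {parent G o v} := by
      ext z
      simp only [children, Set.mem_ofPred_eq, Set.mem_sdiff, SimpleGraph.mem_neighborSet,
        Set.mem_singleton_iff]
      refine and_congr_right fun hz => not_congr ⟨fun hzo => (parent_eq hG hz hzo).symm, ?_⟩
      rintro rfl
      exact h2
    rw [this, Set.encard_sdiff_singleton_of_mem (by exact h1), hcard]

/-- A map of the tree is built outwards from the root: once `v` is sent to `v'`, `σ v v'` sends the
children of `v` to children of `v'`, and `τ` undoes this. Roots must correspond to roots because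
only they have all their neighbours as children. -/
lemma treeRec_leftInverse (hG : G.IsTree) {o o' : V} (σ τ : V → V → V → V)
    (hσ : ∀ v v', (v = o ↔ v' = o') → ∀ z ∈ children G o v,
      σ v v' z ∈ children G o' v' ∧ τ v' v (σ v v' z) = z) (v : V) :
    (v = o ↔ treeRec G o o' (fun z b => σ (parent G o z) b z) v = o') ∧
    treeRec G o' o (fun z b => τ (parent G o' z) b z)
      (treeRec G o o' (fun z b => σ (parent G o z) b z) v) = v ∧
    (v ≠ o → G.Adj (treeRec G o o' (fun z b => σ (parent G o z) b z) (parent G o v))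
      (treeRec G o o' (fun z b => σ (parent G o z) b z) v)) := by
  set f := treeRec G o o' (fun z b => σ (parent G o z) b z) with hf
  set g := treeRec G o' o (fun z b => τ (parent G o' z) b z) with hg
  refine parent_induction hG o (P := fun v => (v = o ↔ f v = o') ∧ g (f v) = v ∧
    (v ≠ o → G.Adj (f (parent G o v)) (f v))) ?_ ?_ v
  · simp [hf, hg, treeRec_root]
  · rintro v hv ⟨ih1, ih2, -⟩
    obtain ⟨h1, h2⟩ := hσ _ _ ih1 v (mem_children_parent hG hv)
    have hfv : f v = σ (parent G o v) (f (parent G o v)) v := treeRec_of_ne hG _ _ hv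
    rw [← hfv] at h1 h2
    obtain ⟨h3, h4⟩ := ne_and_parent_eq_of_mem_children hG h1
    refine ⟨by simp [hv, h3], ?_, fun _ => h1.1⟩
    rw [hg, treeRec_of_ne hG _ _ h3, h4, ← hg, ih2, h2]

/-- A regular tree is vertex-transitive. -/
lemma exists_iso_apply_eq [G.LocallyFinite] (hG : G.IsTree) {d : ℕ}
    (hreg : G.IsRegularOfDegree d) (o o' : V) : ∃ e : G ≃g G, e o = o' := by
  classical
  have hex : ∀ v v', (v = o ↔ v' = o') → ∃ σ τ : V → V, ∀ z z', (z ∈ children G o v →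
      σ z ∈ children G o' v' ∧ τ (σ z) = z) ∧ (z' ∈ children G o' v' →
      τ z' ∈ children G o v ∧ σ (τ z') = z') := by
    intro v v' h
    have hfin : (children G o v).Finite := (G.neighborSet v).toFinite.subset fun z hz => hz.1
    have hcard : (children G o v).encard = (children G o' v').encard := by
      rw [encard_children hG hreg, encard_children hG hreg]
      simp [h]
    have : Nonempty V := ⟨o⟩
    obtain ⟨σ, hσ⟩ := hfin.exists_bijOn_of_encard_eq hcard
    have hinv := hσ.invOn_invFunOn
    refine ⟨σ, Function.invFunOn σ (children G o v), fun z z' => ⟨fun hz => ?_, fun hz => ?_⟩⟩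
    · exact ⟨hσ.mapsTo hz, hinv.1 hz⟩
    · exact ⟨hσ.surjOn.mapsTo_invFunOn hz, hinv.2 hz⟩
  choose! σ τ hστ using hex
  have h1 := treeRec_leftInverse hG (o := o) (o' := o') σ (fun v' v => τ v v')
    (fun v v' h z hz => (hστ v v' h z z).1 hz)
  have h2 := treeRec_leftInverse hG (o := o') (o' := o) (fun v' v => τ v v') σ
    (fun v v' h z hz => (hστ v' v h.symm z z).2 hz)
  -- Every edge of a tree joins a vertex to its parent, so adjacency need only be checked there.
  have hadj : ∀ (r : V) (f : V → V), (∀ v, v ≠ r → G.Adj (f (parent G r v)) (f v)) →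
      ∀ v z, G.Adj v z → G.Adj (f v) (f z) := by
    intro r f hf v z hvz
    rcases eq_parent_or_eq_parent hG r hvz with ⟨h, rfl⟩ | ⟨h, rfl⟩
    · exact (hf v h).symm
    · exact hf z h
  refine ⟨⟨⟨_, _, fun v => (h1 v).2.1, fun v => (h2 v).2.1⟩, fun {v z} => ⟨fun h => ?_, ?_⟩⟩, ?_⟩
  · have := hadj o' _ (fun v => (h2 v).2.2) _ _ h
    simpa only [Equiv.coe_fn_mk, (h1 _).2.1] using this
  · exact hadj o _ (fun v => (h1 v).2.2) _ _
  · exact treeRec_root o o' _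

end Automorphism

/-! ### Bounded functions of part of the configuration -/

section Local

variable {V : Type*} {s t : Set V} {f g : (V → Bool) → ℝ}

/-- `g` is a bounded measurable function of the values on `s`. -/
structure IsBddOn (s : Set V) (g : (V → Bool) → ℝ) : Prop where
  measurable : Measurable g
  bounded : ∃ C, ∀ φ, |g φ| ≤ C
  dependsOn : DependsOn g s

lemma IsBddOn.mono (hg : IsBddOn s g) (h : s ⊆ t) : IsBddOn t g :=
  ⟨hg.measurable, hg.bounded, hg.dependsOn.mono h⟩

lemma isBddOn_const (c : ℝ) : IsBddOn s (fun _ => c) :=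
  ⟨measurable_const, ⟨|c|, fun _ => le_rfl⟩, fun _ _ _ => rfl⟩

lemma IsBddOn.mul (hf : IsBddOn s f) (hg : IsBddOn s g) : IsBddOn s (fun φ => f φ * g φ) := by
  obtain ⟨C, hC⟩ := hf.bounded
  obtain ⟨D, hD⟩ := hg.bounded
  refine ⟨hf.measurable.mul hg.measurable, ⟨C * D, fun φ => ?_⟩, fun φ ψ h => ?_⟩
  · rw [abs_mul]
    exact mul_le_mul (hC φ) (hD φ) (abs_nonneg _) ((abs_nonneg _).trans (hC φ))
  · simp only [hf.dependsOn h, hg.dependsOn h]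

lemma IsBddOn.add (hf : IsBddOn s f) (hg : IsBddOn s g) : IsBddOn s (fun φ => f φ + g φ) := by
  obtain ⟨C, hC⟩ := hf.bounded
  obtain ⟨D, hD⟩ := hg.bounded
  refine ⟨hf.measurable.add hg.measurable, ⟨C + D, fun φ => ?_⟩, fun φ ψ h => ?_⟩
  · exact (abs_add_le _ _).trans (add_le_add (hC φ) (hD φ))
  · simp only [hf.dependsOn h, hg.dependsOn h]

lemma IsBddOn.const_mul (hf : IsBddOn s f) (c : ℝ) : IsBddOn s (fun φ => c * f φ) :=
  (isBddOn_const c).mul hf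

lemma IsBddOn.sub (hf : IsBddOn s f) (hg : IsBddOn s g) : IsBddOn s (fun φ => f φ - g φ) := by
  have := hf.add (hg.const_mul (-1))
  simpa only [neg_mul, one_mul, ← sub_eq_add_neg] using this

lemma IsBddOn.prod {ι : Type*} (T : Finset ι) {F : ι → (V → Bool) → ℝ}
    (h : ∀ i ∈ T, IsBddOn s (F i)) : IsBddOn s (fun φ => ∏ i ∈ T, F i φ) := by
  classical
  induction T using Finset.induction_on with
  | empty => simpa using isBddOn_const (s := s) 1
  | insert i T hi ih =>
    simp only [Finset.prod_insert hi]
    exact (h i (Finset.mem_insert_self i T)).mul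
      (ih fun j hj => h j (Finset.mem_insert_of_mem hj))

lemma IsBddOn.integrable (hg : IsBddOn s g) (ν : Measure (V → Bool)) [IsFiniteMeasure ν] :
    Integrable g ν := by
  obtain ⟨C, hC⟩ := hg.bounded
  exact Integrable.of_bound hg.measurable.aestronglyMeasurable C (ae_of_all _ hC)

lemma IsBddOn.comp {T : (V → Bool) → (V → Bool)} (hg : IsBddOn s g) (hT : Measurable T)
    (h : ∀ v ∈ s, DependsOn (fun φ => T φ v) t) : IsBddOn t (fun φ => g (T φ)) := by
  obtain ⟨C, hC⟩ := hg.bounded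
  exact ⟨hg.measurable.comp hT, ⟨C, fun φ => hC _⟩,
    fun φ ψ hφ => hg.dependsOn fun v hv => h v hv hφ⟩

/-- Resetting the coordinates off `s` to `false` does not change `g`, and the reset map is
measurable for the σ-algebra of `s`. -/
lemma IsBddOn.measurable_cylinderEvents (hg : IsBddOn s g) :
    Measurable[cylinderEvents (X := fun _ : V => Bool) s] g := by
  classical
  let r : (V → Bool) → (V → Bool) := fun φ v => if v ∈ s then φ v else false
  have hr : @Measurable _ _ (cylinderEvents (X := fun _ : V => Bool) s) _ r := by
    refine @measurable_pi_lambda _ _ _ (cylinderEvents (X := fun _ : V => Bool) s) _ _ fun v => ?_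
    by_cases hv : v ∈ s
    · simp only [r, hv, if_true]
      exact measurable_cylinderEvent_apply hv
    · simp only [r, hv, if_false]
      exact @measurable_const _ _ _ (cylinderEvents (X := fun _ : V => Bool) s) _
  have : g = g ∘ r := by
    funext φ
    refine hg.dependsOn fun v hv => ?_
    simp only [r, hv, if_true]
  rw [this]
  exact hg.measurable.comp hr

/-- Every event of the σ-algebra of `s` is invariant under the map `r` resetting the coordinates off
`s`, because its generators are; hence membership in it depends on `s` only. -/
lemma isBddOn_indicator {B : Set (V → Bool)}
    (hB : MeasurableSet[cylinderEvents (X := fun _ : V => Bool) s] B) :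
    IsBddOn s (B.indicator fun _ => (1 : ℝ)) := by
  classical
  refine ⟨measurable_const.indicator (cylinderEvents_le_pi _ hB), ⟨1, fun φ => ?_⟩,
    fun φ ψ h => ?_⟩
  · by_cases h : φ ∈ B <;> simp [h]
  · let r : (V → Bool) → (V → Bool) := fun φ v => if v ∈ s then φ v else false
    have hr : Measurable r := measurable_pi_lambda _ fun v => by
      by_cases hv : v ∈ s
      · simp only [r, hv, if_true]
        exact measurable_pi_apply v
      · simp only [r, hv, if_false]
        exact measurable_const
    have hle : cylinderEvents (X := fun _ : V => Bool) s ≤ MeasurableSpace.invariants r := by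
      refine iSup₂_le fun v hv => ?_
      rintro _ ⟨A, hA, rfl⟩
      refine MeasurableSpace.measurableSet_invariants.mpr
        ⟨measurable_pi_apply v hA, ?_⟩
      ext φ
      simp [r, hv]
    have hinv := (MeasurableSpace.measurableSet_invariants.mp (hle _ hB)).2
    have hφ : r φ = r ψ := by
      funext v
      by_cases hv : v ∈ s
      · simpa [r, hv] using h v hv
      · simp [r, hv]
    have : φ ∈ B ↔ ψ ∈ B := by
      rw [← hinv, Set.mem_preimage, hφ, Set.mem_preimage]
    by_cases h1 : φ ∈ B
    · simp [h1, this.mp h1]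
    · have h2 : ψ ∉ B := fun h2 => h1 (this.mpr h2)
      simp [h1, h2]

/-- The indicator function of the event that `φ u = a`. -/
def spin (u : V) (a : Bool) (φ : V → Bool) : ℝ := if φ u = a then 1 else 0

/-- The indicator function of the event that `u` is occupied. -/
abbrev occ (u : V) : (V → Bool) → ℝ := spin u true

/-- The indicator function of the event that `u` is vacant. -/
abbrev vac (u : V) : (V → Bool) → ℝ := spin u false

lemma spin_nonneg (u : V) (a : Bool) (φ : V → Bool) : 0 ≤ spin u a φ := by
  unfold spin; split_ifs <;> simp

lemma spin_le_one (u : V) (a : Bool) (φ : V → Bool) : spin u a φ ≤ 1 := by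
  unfold spin; split_ifs <;> simp

lemma occ_eq (u : V) (φ : V → Bool) : occ u φ = 1 - vac u φ := by
  cases h : φ u <;> simp [spin, h]

lemma spin_mul_self (u : V) (a : Bool) (φ : V → Bool) : spin u a φ * spin u a φ = spin u a φ := by
  unfold spin; split_ifs <;> simp

lemma spin_eq_indicator (u : V) (a : Bool) :
    spin u a = {φ : V → Bool | φ u = a}.indicator (fun _ => (1 : ℝ)) := by
  funext φ
  by_cases h : φ u = a <;> simp [spin, h]

lemma measurableSet_spin (u : V) (a : Bool) : MeasurableSet {φ : V → Bool | φ u = a} :=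
  measurableSet_eq_fun (measurable_pi_apply u) measurable_const

lemma isBddOn_spin {u : V} (hu : u ∈ s) (a : Bool) : IsBddOn s (spin u a) := by
  rw [spin_eq_indicator]
  exact isBddOn_indicator
    (measurable_cylinderEvent_apply (X := fun _ : V => Bool) hu (measurableSet_singleton a))

lemma integral_spin_mul (ν : Measure (V → Bool)) (u : V) (a : Bool) (f : (V → Bool) → ℝ) :
    ∫ φ, spin u a φ * f φ ∂ν = ∫ φ in {φ | φ u = a}, f φ ∂ν := by
  rw [← integral_indicator (measurableSet_spin u a)]
  congr 1
  funext φ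
  by_cases h : φ u = a <;> simp [spin, h]

lemma integral_spin (ν : Measure (V → Bool)) (u : V) (a : Bool) :
    ∫ φ, spin u a φ ∂ν = ν.real {φ | φ u = a} := by
  have := integral_spin_mul ν u a (fun _ => 1)
  simpa using this

lemma integral_vac (ν : Measure (V → Bool)) [IsProbabilityMeasure ν] (u : V) :
    ∫ φ, vac u φ ∂ν = 1 - ∫ φ, occ u φ ∂ν := by
  have h1 : IsBddOn Set.univ (vac u) := isBddOn_spin (Set.mem_univ u) false
  simp only [occ_eq]
  rw [integral_sub (integrable_const _) (h1.integrable ν)]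
  simp

lemma IsBddOn.integral_eq_add (hf : IsBddOn s f) (ν : Measure (V → Bool)) [IsFiniteMeasure ν]
    (u : V) : ∫ φ, f φ ∂ν = ∫ φ, occ u φ * f φ ∂ν + ∫ φ, vac u φ * f φ ∂ν := by
  have hf' := hf.mono (Set.subset_univ s)
  rw [← integral_add (((isBddOn_spin (Set.mem_univ u) true).mul hf').integrable ν)
    (((isBddOn_spin (Set.mem_univ u) false).mul hf').integrable ν)]
  congr 1
  funext φ
  linear_combination -(f φ) * occ_eq u φ

end Local

/-! ### Conditional independence across a vertex -/

section Simple

variable {V : Type*} {G : SimpleGraph V} {ν : Measure (V → Bool)} {f g : (V → Bool) → ℝ}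

/-- One component of the complement of `u` is tested against all the others grouped together. -/
lemma IsSimple.indep_branch (hG : G.IsTree) (hν : IsSimple G ν) {u w : V} (h : G.Adj u w)
    (a : Bool) (ha : ν {φ | φ u = a} ≠ 0) :
    Indep (cylinderEvents (X := fun _ : V => Bool) (branch G u w))
      (cylinderEvents (X := fun _ : V => Bool) ((branch G u w)ᶜ \ {u})) (ν[|{φ | φ u = a}]) := by
  set C₀ := G.componentComplMk (K := {u}) (show w ∉ ({u} : Set V) from h.ne')
  have hC₀ : C₀.supp = branch G u w := supp_componentComplMk hG h
  have := indep_iSup_of_disjoint (fun _ => cylinderEvents_le_pi) (hν u a ha)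
    (S := {C₀}) (T := {C₀}ᶜ) disjoint_compl_right
  refine indep_of_indep_of_le_left (indep_of_indep_of_le_right this ?_) ?_
  · refine iSup₂_le fun v hv => ?_
    obtain ⟨hv1, hv2⟩ := hv
    have hmem : G.componentComplMk hv2 ∈ ({C₀}ᶜ : Set (G.ComponentCompl {u})) := by
      intro hC
      apply hv1
      rw [← hC₀, ← hC]
      exact SimpleGraph.componentComplMk_mem G hv2
    refine le_trans ?_ (le_iSup₂_of_le (G.componentComplMk hv2) hmem le_rfl)
    exact le_iSup₂_of_le v (SimpleGraph.componentComplMk_mem G hv2) le_rfl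
  · rw [← hC₀]
    exact le_iSup₂_of_le C₀ rfl le_rfl

/-- Given the value at `u`, the configuration on a branch at `u` is independent of the rest. -/
lemma IsSimple.integral_mul (hG : G.IsTree) [IsProbabilityMeasure ν] (hν : IsSimple G ν) {u w : V}
    (h : G.Adj u w) (a : Bool) (hf : IsBddOn (branch G u w) f) (hg : IsBddOn (branch G u w)ᶜ g) :
    (∫ φ, spin u a φ * (f φ * g φ) ∂ν) * ∫ φ, spin u a φ ∂ν =
      (∫ φ, spin u a φ * f φ ∂ν) * ∫ φ, spin u a φ * g φ ∂ν := by
  classical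
  by_cases ha : ν {φ | φ u = a} = 0
  · simp only [integral_spin_mul, integral_spin, Measure.restrict_eq_zero.mpr ha, Measure.real, ha]
    simp
  -- The complement of the branch contains `u`, so `g` may read the value there. Freezing that value
  -- to `a` removes the dependence without changing the product with `spin u a`.
  set g' : (V → Bool) → ℝ := fun φ => g (Function.update φ u a) with hg'
  have hgg : ∀ φ, spin u a φ * g φ = spin u a φ * g' φ := by
    intro φ
    by_cases hφ : φ u = a
    · have : Function.update φ u a = φ := by rw [← hφ, Function.update_eq_self]
      simp only [hg', this]
    · simp [spin, hφ]
  have hg'b : IsBddOn ((branch G u w)ᶜ \ {u}) g' := by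
    refine hg.comp (measurable_update' .. |>.comp (measurable_id.prodMk measurable_const)) ?_
    intro v hv φ ψ hφ
    by_cases hvu : v = u
    · subst hvu; simp
    · simpa [Function.update_of_ne hvu] using hφ v ⟨hv, hvu⟩
  have hind : IndepFun f g' (ν[|{φ | φ u = a}]) :=
    indep_of_indep_of_le_left (indep_of_indep_of_le_right (hν.indep_branch hG h a ha)
      hg'b.measurable_cylinderEvents.comap_le) hf.measurable_cylinderEvents.comap_le
  have key := hind.integral_fun_mul_eq_mul_integral hf.measurable.aestronglyMeasurable
    hg'b.measurable.aestronglyMeasurable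
  have hP : ∀ F : (V → Bool) → ℝ, ∫ φ, spin u a φ * F φ ∂ν =
      ν.real {φ | φ u = a} * ∫ φ, F φ ∂(ν[|{φ | φ u = a}]) := by
    intro F
    rw [integral_spin_mul, ProbabilityTheory.cond, integral_smul_measure, ENNReal.toReal_inv, smul_eq_mul,
      ← mul_assoc, Measure.real, mul_inv_cancel₀, one_mul]
    exact (ENNReal.toReal_pos ha (measure_ne_top _ _)).ne'
  have e1 : ∀ φ, spin u a φ * (f φ * g φ) = spin u a φ * (f φ * g' φ) := by
    intro φ
    rw [mul_left_comm, hgg, mul_left_comm]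
  simp only [e1, hgg]
  rw [hP (fun φ => f φ * g' φ), hP f, hP g', key, integral_spin]
  ring

end Simple

/-! ### The Gibbs property as an identity of integrals -/

section Gibbs

variable {V : Type*} {G : SimpleGraph V} {ν : Measure (V → Bool)} {g : (V → Bool) → ℝ} {lam : ℝ}

/-- Almost surely, no two adjacent vertices are occupied. -/
def IsHardCore (G : SimpleGraph V) (ν : Measure (V → Bool)) : Prop :=
  ∀ u w, G.Adj u w → ∀ᵐ φ ∂ν, occ u φ * occ w φ = 0

lemma IsHardCore.integral_occ_mul (h : IsHardCore G ν) {u w : V} (huw : G.Adj u w)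
    (f : (V → Bool) → ℝ) : ∫ φ, occ u φ * (vac w φ * f φ) ∂ν = ∫ φ, occ u φ * f φ ∂ν := by
  refine integral_congr_ae ?_
  filter_upwards [h u w huw] with φ hφ
  have : vac w φ = 1 - occ w φ := by rw [occ_eq]; ring
  rw [this]
  linear_combination -(f φ) * hφ

/-- The set of configurations for which `u` may be occupied. -/
def freeSet (G : SimpleGraph V) (u : V) : Set (V → Bool) :=
  {φ | G.IsIndepSet (occupied φ ∪ {u})}

lemma mem_freeSet {u : V} {φ : V → Bool} : φ ∈ freeSet G u ↔
    ∀ a b, G.Adj a b → ¬ ((a = u ∨ φ a = true) ∧ (b = u ∨ φ b = true)) := by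
  simp only [freeSet, SimpleGraph.IsIndepSet, Set.Pairwise, occupied, Set.mem_union,
    Set.mem_ofPred_eq, Set.mem_singleton_iff]
  constructor
  · exact fun h a b hab ⟨ha, hb⟩ => h ha.symm hb.symm hab.ne hab
  · exact fun h a ha b hb _ hab => h a b hab ⟨ha.symm, hb.symm⟩

lemma measurableSet_freeSet [Countable V] (u : V) :
    MeasurableSet[cylinderEvents (X := fun _ : V => Bool) {u}ᶜ] (freeSet G u) := by
  have hm : ∀ a : V, MeasurableSet[cylinderEvents (X := fun _ : V => Bool) {u}ᶜ]
      {φ : V → Bool | a = u ∨ φ a = true} := by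
    intro a
    by_cases ha : a = u
    · simp [ha]
    · simp only [ha, false_or]
      exact measurable_cylinderEvent_apply (X := fun _ : V => Bool) (Δ := {u}ᶜ) ha
        (measurableSet_singleton true)
  have : freeSet G u = ⋂ a, ⋂ b, ⋂ _ : G.Adj a b,
      ({φ | a = u ∨ φ a = true} ∩ {φ | b = u ∨ φ b = true})ᶜ := by
    ext φ
    simp [mem_freeSet]
  rw [this]
  exact MeasurableSet.iInter fun a => MeasurableSet.iInter fun b => MeasurableSet.iInter fun _ =>
    ((hm a).inter (hm b)).compl

lemma IsGibbs.integral_occ_mul_eq_freeSet [Countable V] (hν : IsGibbs G lam ν) (u : V)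
    (hg : IsBddOn {u}ᶜ g) : ∫ φ, occ u φ * g φ ∂ν =
      lam / (1 + lam) * ∫ φ, (freeSet G u).indicator (fun _ => 1) φ * g φ ∂ν := by
  have := hν.isProbabilityMeasure
  have ho : IsBddOn Set.univ (occ u) := isBddOn_spin (Set.mem_univ u) true
  have h1 := condExp_mul_of_stronglyMeasurable_right (μ := ν)
    hg.measurable_cylinderEvents.stronglyMeasurable
    ((ho.mul (hg.mono (Set.subset_univ _))).integrable ν) (ho.integrable ν)
  have h2 := hν.condProb_eq u
  rw [← spin_eq_indicator] at h2
  rw [← integral_condExp (cylinderEvents_le_pi (Δ := {u}ᶜ)), ← integral_const_mul]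
  refine integral_congr_ae ?_
  filter_upwards [h1, h2] with φ h1 h2
  have e : (fun φ => occ u φ * g φ) = occ u * g := rfl
  rw [e, h1, Pi.mul_apply, h2]
  by_cases hφ : φ ∈ freeSet G u
  · have hφ' : φ ∈ {φ₀ : V → Bool | G.IsIndepSet (occupied φ₀ ∪ {u})} := hφ
    rw [Set.indicator_of_mem hφ, Set.indicator_of_mem hφ']
    ring
  · have hφ' : φ ∉ {φ₀ : V → Bool | G.IsIndepSet (occupied φ₀ ∪ {u})} := hφ
    rw [Set.indicator_of_notMem hφ, Set.indicator_of_notMem hφ']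
    ring

/-- The Gibbs identity at `u` is tested on `occ w`, which vanishes wherever `u` is allowed to be
occupied. -/
lemma IsGibbs.isHardCore [Countable V] (hν : IsGibbs G lam ν) : IsHardCore G ν := by
  intro u w huw
  have := hν.isProbabilityMeasure
  have hw : IsBddOn ({u}ᶜ : Set V) (occ w) := isBddOn_spin (by simpa using huw.ne') true
  have hu : IsBddOn Set.univ (occ u) := isBddOn_spin (Set.mem_univ u) true
  have h := hν.integral_occ_mul_eq_freeSet u hw
  have h0 : ∀ φ, (freeSet G u).indicator (fun _ => (1 : ℝ)) φ * occ w φ = 0 := by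
    intro φ
    by_cases hφ : φ ∈ freeSet G u
    · have : ¬ φ w = true := fun h => mem_freeSet.mp hφ u w huw ⟨Or.inl rfl, Or.inr h⟩
      simp [spin, this]
    · simp [hφ]
  simp only [h0, integral_zero, mul_zero] at h
  exact (integral_eq_zero_iff_of_nonneg
    (fun φ => mul_nonneg (spin_nonneg _ _ _) (spin_nonneg _ _ _))
    ((hu.mul (hw.mono (Set.subset_univ _))).integrable ν)).mp h

variable [G.LocallyFinite]

/-- The indicator function of the event that all neighbours of `u` are vacant. -/
noncomputable def vacNbr (G : SimpleGraph V) [G.LocallyFinite] (u : V) (φ : V → Bool) : ℝ :=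
  ∏ w ∈ G.neighborFinset u, vac w φ

lemma isBddOn_vacNbr (u : V) : IsBddOn {u}ᶜ (vacNbr G u) :=
  IsBddOn.prod _ fun w hw => isBddOn_spin
    (by simpa using ((G.mem_neighborFinset u w).mp hw).ne') false

/-- Independence of the whole set with `u` added is a global condition, but the occupied set is
almost surely independent already (there are countably many edges), so only the neighbours of `u`
matter. -/
lemma IsHardCore.indicator_freeSet [Countable V] (h : IsHardCore G ν) (u : V) :
    ∀ᵐ φ ∂ν, (freeSet G u).indicator (fun _ => (1 : ℝ)) φ = vacNbr G u φ := by
  have hall : ∀ᵐ φ ∂ν, ∀ a b, G.Adj a b → occ a φ * occ b φ = 0 := by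
    simp only [ae_all_iff]
    exact h
  filter_upwards [hall] with φ hφ
  have hφ' : ∀ a b, G.Adj a b → ¬ (φ a = true ∧ φ b = true) := by
    rintro a b hab ⟨ha, hb⟩
    simpa [spin, ha, hb] using hφ a b hab
  by_cases hf : φ ∈ freeSet G u
  · rw [Set.indicator_of_mem hf, vacNbr, Finset.prod_eq_one]
    intro w hw
    have : ¬ φ w = true := fun h =>
      mem_freeSet.mp hf u w ((G.mem_neighborFinset u w).mp hw) ⟨Or.inl rfl, Or.inr h⟩
    simp [spin, this]
  · rw [Set.indicator_of_notMem hf]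
    have : ∃ w, G.Adj u w ∧ φ w = true := by
      by_contra! hno
      refine hf (mem_freeSet.mpr ?_)
      rintro a b hab ⟨ha | ha, hb | hb⟩
      · exact hab.ne (ha.trans hb.symm)
      · exact hno b (ha ▸ hab) hb
      · exact hno a (hb ▸ hab.symm) ha
      · exact hφ' a b hab ⟨ha, hb⟩
    obtain ⟨w, hw, hwφ⟩ := this
    rw [vacNbr, Finset.prod_eq_zero ((G.mem_neighborFinset u w).mpr hw)]
    simp [spin, hwφ]

lemma IsHardCore.integral_occ_mul_vacNbr (h : IsHardCore G ν) (u : V) (f : (V → Bool) → ℝ) :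
    ∫ φ, occ u φ * (vacNbr G u φ * f φ) ∂ν = ∫ φ, occ u φ * f φ ∂ν := by
  refine integral_congr_ae ?_
  have hall : ∀ᵐ φ ∂ν, ∀ w ∈ G.neighborFinset u, occ u φ * occ w φ = 0 :=
    (Finset.eventually_all _).mpr fun w hw => h u w ((G.mem_neighborFinset u w).mp hw)
  filter_upwards [hall] with φ hφ
  by_cases hu : φ u = true
  · have : vacNbr G u φ = 1 := by
      refine Finset.prod_eq_one fun w hw => ?_
      have h1 := hφ w hw
      have h2 : occ u φ = 1 := by simp [spin, hu]
      rw [h2, one_mul, occ_eq] at h1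
      linarith
    rw [this, one_mul]
  · simp [spin, hu]

/-- The defining property of a Gibbs measure, as an identity of integrals. -/
lemma IsGibbs.integral_occ_mul [Countable V] (hlam : 0 < lam) (hν : IsGibbs G lam ν) (u : V)
    (hg : IsBddOn {u}ᶜ g) :
    ∫ φ, occ u φ * g φ ∂ν = lam * ∫ φ, vac u φ * (vacNbr G u φ * g φ) ∂ν := by
  have := hν.isProbabilityMeasure
  have h1 := hν.integral_occ_mul_eq_freeSet u hg
  have h2 : ∫ φ, (freeSet G u).indicator (fun _ => 1) φ * g φ ∂ν =
      ∫ φ, vacNbr G u φ * g φ ∂ν := by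
    refine integral_congr_ae ?_
    filter_upwards [hν.isHardCore.indicator_freeSet u] with φ hφ
    rw [hφ]
  have hN : IsBddOn Set.univ (fun φ => vacNbr G u φ * g φ) :=
    ((isBddOn_vacNbr u).mul hg).mono (Set.subset_univ _)
  have h3 : ∫ φ, vacNbr G u φ * g φ ∂ν = ∫ φ, occ u φ * g φ ∂ν +
      ∫ φ, vac u φ * (vacNbr G u φ * g φ) ∂ν := by
    rw [← hν.isHardCore.integral_occ_mul_vacNbr u g, hN.integral_eq_add ν u]
  -- Solving for the integral with `occ u` turns the probability λ/(1 + λ) into the odds λ.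
  rw [h2, h3, div_mul_eq_mul_div, eq_div_iff (by positivity)] at h1
  linarith

lemma isGibbs_of_integral_occ_mul [Countable V] (hlam : 0 < lam) [IsProbabilityMeasure ν]
    (hc : IsHardCore G ν)
    (h : ∀ (u : V) (B : Set (V → Bool)),
      MeasurableSet[cylinderEvents (X := fun _ : V => Bool) {u}ᶜ] B →
      ∫ φ, occ u φ * B.indicator (fun _ => 1) φ ∂ν =
        lam * ∫ φ, vac u φ * (vacNbr G u φ * B.indicator (fun _ => 1) φ) ∂ν) :
    IsGibbs G lam ν := by
  refine ⟨inferInstance, fun u => ?_⟩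
  have ho : IsBddOn Set.univ (occ u) := isBddOn_spin (Set.mem_univ u) true
  have hJ := measurableSet_freeSet (G := G) u
  rw [← spin_eq_indicator]
  symm
  refine ae_eq_condExp_of_forall_setIntegral_eq cylinderEvents_le_pi (ho.integrable ν) ?_ ?_ ?_
  · exact fun B _ _ => ((integrable_const _).indicator (cylinderEvents_le_pi _ hJ)).integrableOn
  · intro B hB _
    have hB' := cylinderEvents_le_pi _ hB
    set g : (V → Bool) → ℝ := B.indicator fun _ => 1 with hgdef
    have hg : IsBddOn {u}ᶜ g := isBddOn_indicator hB
    have hN : IsBddOn Set.univ (fun φ => vacNbr G u φ * g φ) :=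
      ((isBddOn_vacNbr u).mul hg).mono (Set.subset_univ _)
    have h3 : ∫ φ, vacNbr G u φ * g φ ∂ν = ∫ φ, occ u φ * g φ ∂ν +
        ∫ φ, vac u φ * (vacNbr G u φ * g φ) ∂ν := by
      rw [← hc.integral_occ_mul_vacNbr u g, hN.integral_eq_add ν u]
    have h4 : ∫ φ in B, occ u φ ∂ν = ∫ φ, occ u φ * g φ ∂ν := by
      rw [← integral_indicator hB']
      congr 1
      funext φ
      by_cases hφ : φ ∈ B <;> simp [hgdef, hφ]
    have h5 : ∫ φ in B, {φ₀ : V → Bool | G.IsIndepSet (occupied φ₀ ∪ {u})}.indicator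
        (fun _ => lam / (1 + lam)) φ ∂ν = lam / (1 + lam) * ∫ φ, vacNbr G u φ * g φ ∂ν := by
      rw [← integral_indicator hB', ← integral_const_mul]
      refine integral_congr_ae ?_
      filter_upwards [hc.indicator_freeSet u] with φ hφ
      rw [← hφ]
      change B.indicator (fun φ => (freeSet G u).indicator (fun _ => lam / (1 + lam)) φ) φ = _
      by_cases h1 : φ ∈ B <;> by_cases h2 : φ ∈ freeSet G u <;> simp [hgdef, h1, h2]
    rw [h4, h5, h3, h u B hB]
    field_simp
    ring
  · exact (measurable_const.indicator hJ).aestronglyMeasurable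

end Gibbs

/-! ### The posterior probability of vacancy -/

section Posterior

variable {V : Type*} {G : SimpleGraph V} {ν : Measure (V → Bool)}
  {g : (V → Bool) → ℝ} {lam : ℝ}

/-- The vertices of the branch from `u` to `w` at distance less than `n` from `w`. -/
def initialBranch (G : SimpleGraph V) : ℕ → V → V → Set V
  | 0, _, _ => ∅
  | n + 1, u, w => insert w (⋃ z ∈ {z | G.Adj w z ∧ z ≠ u}, initialBranch G n w z)

lemma initialBranch_subset (hG : G.IsTree) (n : ℕ) {u w : V} (h : G.Adj u w) :
    initialBranch G n u w ⊆ branch G u w := by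
  induction n generalizing u w with
  | zero => exact Set.empty_subset _
  | succ n ih =>
    refine Set.insert_subset (mem_branch_right h) (Set.iUnion₂_subset fun z hz => ?_)
    exact (ih hz.1).trans (branch_subset_branch hG h hz.1 hz.2)

lemma disjoint_branch_initialBranch (hG : G.IsTree) (n : ℕ) {w z z' : V} (h : G.Adj w z)
    (h' : G.Adj w z') (hne : z ≠ z') : Disjoint (branch G w z) (initialBranch G n w z') :=
  (disjoint_branch hG h h' hne).mono_right (initialBranch_subset hG n h')

variable [G.LocallyFinite]

/-- The probability, for the hard-core model on the branch from `u` to `w` cut off at depth `n`,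
that `w` is vacant given the values outside, when `u` is vacant. -/
noncomputable def posterior (G : SimpleGraph V) [G.LocallyFinite] (lam : ℝ) :
    ℕ → V → V → (V → Bool) → ℝ
  | 0, _, w, φ => vac w φ
  | n + 1, u, w, φ =>
    open Classical in (1 + lam * ∏ z ∈ (G.neighborFinset w).erase u, posterior G lam n w z φ)⁻¹

lemma posterior_nonneg (hlam : 0 < lam) (n : ℕ) (u w : V) (φ : V → Bool) :
    0 ≤ posterior G lam n u w φ := by
  classical
  induction n generalizing u w with
  | zero => exact spin_nonneg _ _ _
  | succ n ih =>
    have : 0 ≤ ∏ z ∈ (G.neighborFinset w).erase u, posterior G lam n w z φ :=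
      Finset.prod_nonneg fun z _ => ih w z
    rw [posterior]
    positivity

lemma posterior_le_one (hlam : 0 < lam) (n : ℕ) (u w : V) (φ : V → Bool) :
    posterior G lam n u w φ ≤ 1 := by
  classical
  cases n with
  | zero => exact spin_le_one _ _ _
  | succ n =>
    have : 0 ≤ ∏ z ∈ (G.neighborFinset w).erase u, posterior G lam n w z φ :=
      Finset.prod_nonneg fun z _ => posterior_nonneg hlam n w z φ
    rw [posterior]
    exact inv_le_one_of_one_le₀ (by nlinarith)

/-- The recursion reads only vertices at distance exactly `n` from `w`, whereas the initial branch
stops at distance `n - 1`. -/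
lemma isBddOn_posterior (hG : G.IsTree) (hlam : 0 < lam) (n : ℕ) {u w : V} (h : G.Adj u w) :
    IsBddOn (branch G u w \ initialBranch G n u w) (posterior G lam n u w) := by
  classical
  induction n generalizing u w with
  | zero =>
    have : w ∈ branch G u w \ initialBranch G 0 u w :=
      ⟨mem_branch_right h, Set.notMem_empty _⟩
    exact isBddOn_spin this false
  | succ n ih =>
    have hp : IsBddOn (branch G u w \ initialBranch G (n + 1) u w)
        (fun φ => ∏ z ∈ (G.neighborFinset w).erase u, posterior G lam n w z φ) := by
      refine IsBddOn.prod _ fun z hz => ?_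
      obtain ⟨hzu, hz⟩ := Finset.mem_erase.mp hz
      rw [SimpleGraph.mem_neighborFinset] at hz
      refine (ih hz).mono fun x hx => ⟨branch_subset_branch hG h hz hzu hx.1, ?_⟩
      rintro (rfl | hx')
      · exact notMem_branch_left _ _ hx.1
      · obtain ⟨z', hz', hx'⟩ := Set.mem_iUnion₂.mp hx'
        by_cases hzz : z = z'
        · subst hzz; exact hx.2 hx'
        · exact Set.disjoint_left.mp (disjoint_branch_initialBranch hG n hz hz'.1 hzz) hx.1 hx'
    refine ⟨?_, ⟨1, fun φ => ?_⟩, fun φ ψ hφ => ?_⟩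
    · exact (hp.measurable.const_mul lam |>.const_add 1).inv
    · rw [abs_of_nonneg (posterior_nonneg hlam _ _ _ _)]
      exact posterior_le_one hlam _ _ _ _
    · simp only [posterior, hp.dependsOn hφ]

lemma isBddOn_compl_posterior (hG : G.IsTree) (hlam : 0 < lam) (n : ℕ) {u w : V}
    (h : G.Adj u w) : IsBddOn (initialBranch G n u w)ᶜ (posterior G lam n u w) :=
  (isBddOn_posterior hG hlam n h).mono fun _ hx => hx.2

/-- The conditional probability that `w` is vacant given the values outside an initial part of the
branch from `u` to `w` is, when `u` is vacant, the posterior probability. -/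
lemma IsGibbs.integral_vac_mul_vac_mul (hG : G.IsTree) (hlam : 0 < lam) (hν : IsGibbs G lam ν)
    (n : ℕ) {u w : V} (h : G.Adj u w) (hg : IsBddOn (initialBranch G n u w)ᶜ g) :
    ∫ φ, vac u φ * (vac w φ * g φ) ∂ν = ∫ φ, vac u φ * (posterior G lam n u w φ * g φ) ∂ν := by
  classical
  have := countable_of_isTree hG
  have := hν.isProbabilityMeasure
  induction n generalizing u w g with
  | zero => rfl
  | succ n ih =>
    -- The indicators of vacant children are exchanged for posteriors one at a time. The initial
    -- pieces below distinct children are disjoint, so the other factors remain admissible test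
    -- functions.
    have hyb : ∀ (T : Finset V), T ⊆ (G.neighborFinset w).erase u → ∀ f : (V → Bool) → ℝ,
        IsBddOn (⋃ z ∈ T, initialBranch G n w z)ᶜ f →
        ∫ φ, vac w φ * ((∏ z ∈ T, vac z φ) * f φ) ∂ν =
          ∫ φ, vac w φ * ((∏ z ∈ T, posterior G lam n w z φ) * f φ) ∂ν := by
      intro T
      induction T using Finset.induction_on with
      | empty => intro _ f _; simp
      | insert z T hzT ihT =>
        intro hT f hf
        have hz : G.Adj w z := by
          have := Finset.mem_of_mem_erase (hT (Finset.mem_insert_self z T))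
          rwa [SimpleGraph.mem_neighborFinset] at this
        have hTadj : ∀ z' ∈ T, G.Adj w z' ∧ z ≠ z' := fun z' hz' => by
          refine ⟨?_, fun h => hzT (h ▸ hz')⟩
          have := Finset.mem_of_mem_erase (hT (Finset.mem_insert_of_mem hz'))
          rwa [SimpleGraph.mem_neighborFinset] at this
        have hsub : (⋃ z' ∈ insert z T, initialBranch G n w z')ᶜ ⊆ (initialBranch G n w z)ᶜ :=
          Set.compl_subset_compl.mpr fun x hx =>
            Set.mem_iUnion₂.mpr ⟨z, Finset.mem_insert_self z T, hx⟩
        have h1 : IsBddOn (initialBranch G n w z)ᶜ (fun φ => (∏ z' ∈ T, vac z' φ) * f φ) := by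
          refine IsBddOn.mul (IsBddOn.prod _ fun z' hz' => isBddOn_spin (fun hmem => ?_) false)
            (hf.mono hsub)
          exact Set.disjoint_left.mp (disjoint_branch_initialBranch hG n (hTadj z' hz').1 hz
            (hTadj z' hz').2.symm) (mem_branch_right (hTadj z' hz').1) hmem
        have h2 : IsBddOn (⋃ z ∈ T, initialBranch G n w z)ᶜ
            (fun φ => posterior G lam n w z φ * f φ) := by
          refine IsBddOn.mul ((isBddOn_posterior hG hlam n hz).mono fun x hx hx' => ?_)
            (hf.mono (Set.compl_subset_compl.mpr (Set.biUnion_subset_biUnion_left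
              fun z' hz' => Finset.mem_insert_of_mem hz')))
          obtain ⟨z', hz', hx'⟩ := Set.mem_iUnion₂.mp hx'
          exact Set.disjoint_left.mp (disjoint_branch_initialBranch hG n hz (hTadj z' hz').1
            (hTadj z' hz').2) hx.1 hx'
        calc ∫ φ, vac w φ * ((∏ z' ∈ insert z T, vac z' φ) * f φ) ∂ν
            = ∫ φ, vac w φ * (vac z φ * ((∏ z' ∈ T, vac z' φ) * f φ)) ∂ν := by
              simp only [Finset.prod_insert hzT, mul_assoc]
          _ = ∫ φ, vac w φ * ((∏ z' ∈ T, vac z' φ) * (posterior G lam n w z φ * f φ)) ∂ν := by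
              rw [ih hz h1]
              simp only [mul_left_comm]
          _ = ∫ φ, vac w φ * ((∏ z' ∈ insert z T, posterior G lam n w z' φ) * f φ) ∂ν := by
              rw [ihT (fun z' hz' => hT (Finset.mem_insert_of_mem hz')) _ h2]
              simp only [Finset.prod_insert hzT, mul_assoc, mul_left_comm]
    set N := (G.neighborFinset w).erase u with hN
    -- The Gibbs identity at `w` is applied to the target integrand, which does not read `w`.
    set f : (V → Bool) → ℝ := fun φ => vac u φ * (posterior G lam (n + 1) u w φ * g φ) with hfdef
    have hu : u ∉ initialBranch G (n + 1) u w := fun hmem =>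
      notMem_branch_left _ _ (initialBranch_subset hG (n + 1) h hmem)
    have hf : IsBddOn (initialBranch G (n + 1) u w)ᶜ f :=
      (isBddOn_spin hu false).mul ((isBddOn_compl_posterior hG hlam (n + 1) h).mul hg)
    have hf' : IsBddOn Set.univ f := hf.mono (Set.subset_univ _)
    have hfw : IsBddOn {w}ᶜ f :=
      hf.mono (Set.compl_subset_compl.mpr (Set.singleton_subset_iff.mpr (Set.mem_insert _ _)))
    have hfN : IsBddOn (⋃ z ∈ N, initialBranch G n w z)ᶜ f := by
      refine hf.mono (Set.compl_subset_compl.mpr ?_)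
      refine Set.Subset.trans (Set.iUnion₂_subset fun z hz => ?_) (Set.subset_insert _ _)
      obtain ⟨hzu, hz⟩ := Finset.mem_erase.mp hz
      rw [SimpleGraph.mem_neighborFinset] at hz
      exact fun x hx => Set.mem_iUnion₂.mpr ⟨z, ⟨hz, hzu⟩, hx⟩
    have hocc : ∫ φ, occ w φ * f φ ∂ν =
        lam * ∫ φ, vac w φ * ((∏ z ∈ N, posterior G lam n w z φ) * f φ) ∂ν := by
      rw [hν.integral_occ_mul hlam w hfw, ← hyb N subset_rfl f hfN]
      congr 2
      funext φ
      have : vacNbr G w φ = vac u φ * ∏ z ∈ N, vac z φ := by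
        have hmem : u ∈ G.neighborFinset w := (G.mem_neighborFinset w u).mpr h.symm
        rw [vacNbr, hN, Finset.mul_prod_erase _ (fun z => vac z φ) hmem]
      rw [this, hfdef]
      simp only
      -- The factor `vac u` of `vacNbr G w` is absorbed by the one already in `f`.
      have e := spin_mul_self u false φ
      linear_combination (vac w φ * (∏ z ∈ N, vac z φ) * (posterior G lam (n + 1) u w φ * g φ)) * e
    have hprod : IsBddOn Set.univ (fun φ => ∏ z ∈ N, posterior G lam n w z φ) :=
      IsBddOn.prod _ fun z hz => (isBddOn_posterior hG hlam n ((by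
        have := Finset.mem_of_mem_erase hz
        rwa [SimpleGraph.mem_neighborFinset] at this) : G.Adj w z)).mono (Set.subset_univ _)
    have hv : IsBddOn Set.univ (vac w) := isBddOn_spin (Set.mem_univ w) false
    calc ∫ φ, vac u φ * (vac w φ * g φ) ∂ν
        = ∫ φ, vac w φ * f φ + lam * (vac w φ * ((∏ z ∈ N, posterior G lam n w z φ) * f φ)) ∂ν := by
          congr 1
          funext φ
          have hpos : 0 ≤ ∏ z ∈ N, posterior G lam n w z φ :=
            Finset.prod_nonneg fun z _ => posterior_nonneg hlam n w z φ
          -- The recursion is chosen so that the weights of `w` vacant and `w` occupied, 1 and λ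
          -- times the product, sum to the inverse of the posterior.
          have e : posterior G lam (n + 1) u w φ *
              (1 + lam * ∏ z ∈ N, posterior G lam n w z φ) = 1 := by
            rw [posterior]
            exact inv_mul_cancel₀ (by positivity)
          rw [hfdef]
          simp only
          linear_combination -(vac u φ * vac w φ * g φ) * e
      _ = ∫ φ, vac w φ * f φ ∂ν + ∫ φ, occ w φ * f φ ∂ν := by
          rw [integral_add ((hv.mul hf').integrable ν)
            (((hv.mul (hprod.mul hf')).const_mul lam).integrable ν), integral_const_mul, hocc]
      _ = ∫ φ, f φ ∂ν := by
          rw [hf'.integral_eq_add ν w, add_comm]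

end Posterior

/-! ### Chains are determined by their transition probability -/

section Chain

variable {V : Type*} {G : SimpleGraph V} {μ ν : Measure (V → Bool)} {f g : (V → Bool) → ℝ}
  {lam p q : ℝ}

/-- `ν` is the law of a hard-core Markov chain indexed by `G`: given that `u` is vacant and given
all values on the far side of `u`, a neighbour `w` of `u` is vacant with probability `q`. -/
structure IsChain (G : SimpleGraph V) (q : ℝ) (ν : Measure (V → Bool)) : Prop where
  isProbabilityMeasure : IsProbabilityMeasure ν
  isHardCore : IsHardCore G ν
  transition : ∀ u w, G.Adj u w → ∀ g : (V → Bool) → ℝ, IsBddOn (branch G u w)ᶜ g →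
    ∫ φ, vac u φ * (vac w φ * g φ) ∂ν = q * ∫ φ, vac u φ * g φ ∂ν

lemma IsChain.integral_vac_mul (h : IsChain G q ν) {u w : V} (huw : G.Adj u w)
    (hg : IsBddOn (branch G u w)ᶜ g) :
    ∫ φ, vac w φ * g φ ∂ν = ∫ φ, occ u φ * g φ ∂ν + q * ∫ φ, vac u φ * g φ ∂ν := by
  have := h.isProbabilityMeasure
  have hw : IsBddOn Set.univ (fun φ => vac w φ * g φ) :=
    (isBddOn_spin (Set.mem_univ w) false).mul (hg.mono (Set.subset_univ _))
  rw [hw.integral_eq_add ν u, h.isHardCore.integral_occ_mul huw, h.transition u w huw g hg]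

/-- Reading the edge in both directions gives π_w + (1 - q)π_u = 1 = π_u + (1 - q)π_w for the
vacancy probabilities. Thus the one-vertex law follows from `q` without assuming invariance. -/
lemma IsChain.integral_vac (h : IsChain G q ν) (hq : q ≠ 0) (hq2 : q ≠ 2) {u w : V}
    (huw : G.Adj u w) : ∫ φ, vac u φ ∂ν = (2 - q)⁻¹ := by
  have := h.isProbabilityMeasure
  have h1 := h.integral_vac_mul huw (isBddOn_const 1)
  have h2 := h.integral_vac_mul huw.symm (isBddOn_const 1)
  simp only [mul_one] at h1 h2
  have h3 := HardCore.integral_vac ν u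
  have h4 := HardCore.integral_vac ν w
  have hq2' : 2 - q ≠ 0 := sub_ne_zero.mpr hq2.symm
  have h5 : q * (∫ φ, vac u φ ∂ν - ∫ φ, vac w φ ∂ν) = 0 := by linarith
  have h6 := (mul_eq_zero.mp h5).resolve_left hq
  refine eq_inv_of_mul_eq_one_left ?_
  have h7 : ∫ φ, vac w φ ∂ν = ∫ φ, vac u φ ∂ν := by linarith
  rw [h7] at h1
  linarith

/-- Only `w` has its parent outside the branch. Consequently, a farthest vertex of a finite set can
be removed with the rest lying outside its branch. -/
lemma dist_lt_of_mem_branch (hG : G.IsTree) {o w : V} (hw : w ≠ o) (v : V)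
    (hv : v ∈ branch G (parent G o w) w) : v = w ∨ G.dist o w < G.dist o v := by
  obtain ⟨hadj, ho⟩ := parent_spec hG hw
  revert hv
  refine parent_induction hG o (P := fun v => v ∈ branch G (parent G o w) w →
    v = w ∨ G.dist o w < G.dist o v) ?_ ?_ v
  · intro h
    rw [← compl_branch hG hadj.symm] at ho
    exact absurd h ho
  · intro v hv ih hvb
    obtain ⟨hvp, -⟩ := parent_spec hG hv
    by_cases hpu : parent G o v = parent G o w
    · left
      rw [hpu] at hvp
      exact eq_of_mem_branch hG hvp.symm hadj.symm (mem_branch_right hvp.symm) hvb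
    · right
      have hd := dist_parent hG hv
      rcases ih (mem_branch_of_adj hG hadj.symm hvp hpu hvb) with h | h
      · rw [h] at hd; omega
      · omega

/-- A vertex of `S` farthest from `o` is integrated out using the transition from its parent. This
replaces it by the parent, so the sum of the distances to `o` drops; what is left in the end depends
on `o` alone. -/
lemma IsChain.integral_eq (hG : G.IsTree) (hq : q ≠ 0) (hq2 : q ≠ 2) (hμ : IsChain G q μ)
    (hν : IsChain G q ν) {o w₀ : V} (how : G.Adj o w₀) (S : Finset V)
    (hg : IsBddOn (S : Set V) g) : ∫ φ, g φ ∂μ = ∫ φ, g φ ∂ν := by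
  classical
  have := hμ.isProbabilityMeasure
  have := hν.isProbabilityMeasure
  suffices H : ∀ (n : ℕ) (S : Finset V) (g : (V → Bool) → ℝ), ∑ v ∈ S, G.dist o v = n →
      IsBddOn (S : Set V) g → ∫ φ, g φ ∂μ = ∫ φ, g φ ∂ν from H _ S g rfl hg
  intro n
  induction n using Nat.strong_induction_on with
  | _ n ih =>
    intro S g hn hg
    have hup : ∀ (w : V) (a : Bool), IsBddOn ((S.erase w : Finset V) : Set V)
        (fun φ => g (Function.update φ w a)) := by
      intro w a
      refine hg.comp (measurable_update' .. |>.comp (measurable_id.prodMk measurable_const)) ?_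
      intro v hv φ ψ hφ
      by_cases hvw : v = w
      · subst hvw; simp
      · simpa [Function.update_of_ne hvw] using
          hφ v (Finset.mem_coe.mpr (Finset.mem_erase.mpr ⟨hvw, hv⟩))
    have hsplit : ∀ w, (fun φ => g φ) = fun φ => g (Function.update φ w true) +
        vac w φ * (g (Function.update φ w false) - g (Function.update φ w true)) := by
      intro w
      funext φ
      cases hφ : φ w
      · have : Function.update φ w false = φ := by rw [← hφ, Function.update_eq_self]
        simp [spin, hφ, this]
      · have : Function.update φ w true = φ := by rw [← hφ, Function.update_eq_self]
        simp [spin, hφ, this]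
    have hu : ∀ w, IsBddOn (Set.univ : Set V) (vac w) := fun w =>
      isBddOn_spin (Set.mem_univ w) false
    by_cases hS : ∃ v ∈ S, v ≠ o
    · obtain ⟨w, hw, hmax⟩ := (S.filter (· ≠ o)).exists_max_image (G.dist o)
        (by obtain ⟨v, hv, hvo⟩ := hS; exact ⟨v, Finset.mem_filter.mpr ⟨hv, hvo⟩⟩)
      obtain ⟨hwS, hwo⟩ := Finset.mem_filter.mp hw
      obtain ⟨hadj, -⟩ := parent_spec hG hwo
      set u := parent G o w with hudef
      have hd : G.dist o w = G.dist o u + 1 := dist_parent hG hwo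
      have hsub : ((S.erase w : Finset V) : Set V) ⊆ (branch G u w)ᶜ := by
        intro v hv hvb
        obtain ⟨hvw, hvS⟩ := Finset.mem_erase.mp (Finset.mem_coe.mp hv)
        rcases dist_lt_of_mem_branch hG hwo v hvb with h | h
        · exact hvw h
        · have hvo : v ≠ o := by rintro rfl; simp at h
          have := hmax v (Finset.mem_filter.mpr ⟨hvS, hvo⟩)
          omega
      have hlt : ∑ v ∈ insert u (S.erase w), G.dist o v < n := by
        have h1 : ∑ v ∈ insert u (S.erase w), G.dist o v ≤
            G.dist o u + ∑ v ∈ S.erase w, G.dist o v := by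
          by_cases hmem : u ∈ S.erase w
          · rw [Finset.insert_eq_of_mem hmem]; omega
          · rw [Finset.sum_insert hmem]
        have h2 := Finset.add_sum_erase S (G.dist o) hwS
        omega
      have hsub' : ((S.erase w : Finset V) : Set V) ⊆ ((insert u (S.erase w) : Finset V) : Set V) :=
        Finset.coe_subset.mpr (Finset.subset_insert _ _)
      have hmemu : u ∈ ((insert u (S.erase w) : Finset V) : Set V) :=
        Finset.mem_coe.mpr (Finset.mem_insert_self _ _)
      have ih' : ∀ f : (V → Bool) → ℝ, IsBddOn ((insert u (S.erase w) : Finset V) : Set V) f →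
          ∫ φ, f φ ∂μ = ∫ φ, f φ ∂ν := fun f hf => ih _ hlt _ f rfl hf
      have hdiff := (hup w false).sub (hup w true)
      rw [hsplit w, integral_add ((hup w true).integrable μ)
          (((hu w).mul (hdiff.mono (Set.subset_univ _))).integrable μ),
        integral_add ((hup w true).integrable ν)
          (((hu w).mul (hdiff.mono (Set.subset_univ _))).integrable ν),
        hμ.integral_vac_mul hadj.symm (hdiff.mono hsub),
        hν.integral_vac_mul hadj.symm (hdiff.mono hsub),
        ih' _ ((hup w true).mono hsub'),
        ih' _ ((isBddOn_spin hmemu true).mul (hdiff.mono hsub')),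
        ih' _ ((isBddOn_spin hmemu false).mul (hdiff.mono hsub'))]
    · push Not at hS
      have hempty : (S.erase o : Finset V) = ∅ := by
        ext v
        simp only [Finset.mem_erase, Finset.notMem_empty, iff_false, not_and]
        exact fun hne hv => hne (hS v hv)
      have hconst : ∀ a φ, g (Function.update φ o a) = g (Function.update (fun _ => false) o a) := by
        intro a φ
        refine (hup o a).dependsOn (x := φ) (y := fun _ => false) ?_
        simp [hempty]
      rw [hsplit o]
      simp only [hconst]
      rw [integral_add (integrable_const _) (((hu o).mul (isBddOn_const _)).integrable μ),
        integral_add (integrable_const _) (((hu o).mul (isBddOn_const _)).integrable ν),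
        integral_mul_const, integral_mul_const, hμ.integral_vac hq hq2 how,
        hν.integral_vac hq hq2 how]
      simp

/-- The law of the chain is determined by the transition probability. -/
lemma IsChain.eq (hG : G.IsTree) (hq : q ≠ 0) (hq2 : q ≠ 2) (hμ : IsChain G q μ)
    (hν : IsChain G q ν) {o w₀ : V} (how : G.Adj o w₀) : μ = ν := by
  have := hμ.isProbabilityMeasure
  have := hν.isProbabilityMeasure
  refine ext_of_generate_finite (measurableCylinders fun _ : V => Bool)
    generateFrom_measurableCylinders.symm isPiSystem_measurableCylinders ?_ (by simp)
  intro B hB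
  obtain ⟨S, T, hT, rfl⟩ := (mem_measurableCylinders B).mp hB
  have hm : MeasurableSet (cylinder S T) := MeasurableSet.cylinder (α := fun _ : V => Bool) S hT
  have hb : IsBddOn (S : Set V) ((cylinder S T).indicator fun _ => (1 : ℝ)) := by
    refine ⟨measurable_const.indicator hm, ⟨1, fun φ => ?_⟩, fun φ ψ h => ?_⟩
    · by_cases h : φ ∈ cylinder S T <;> simp [h]
    · have : S.restrict φ = S.restrict ψ := by
        funext v
        exact h v v.2
      have hiff : φ ∈ cylinder S T ↔ ψ ∈ cylinder S T := by
        rw [mem_cylinder, mem_cylinder, this]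
      by_cases h1 : φ ∈ cylinder S T
      · rw [Set.indicator_of_mem h1, Set.indicator_of_mem (hiff.mp h1)]
      · rw [Set.indicator_of_notMem h1, Set.indicator_of_notMem fun h2 => h1 (hiff.mpr h2)]
  have := hμ.integral_eq hG hq hq2 hν how S hb
  rw [integral_indicator_const _ hm, integral_indicator_const _ hm] at this
  simp only [smul_eq_mul, mul_one] at this
  exact (measureReal_eq_measureReal_iff).mp this

lemma measurable_comp_iso (e : G ≃g G) : Measurable fun (φ : V → Bool) v => φ (e v) :=
  measurable_pi_lambda _ fun v => measurable_pi_apply (e v)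

/-- The image of a chain under an automorphism is a chain with the same `q`, hence the same measure.
-/
lemma IsChain.isInvariant (hG : G.IsTree) (hq : q ≠ 0) (hq2 : q ≠ 2) (hν : IsChain G q ν)
    {o w₀ : V} (how : G.Adj o w₀) : IsInvariant G ν := by
  intro e
  have := hν.isProbabilityMeasure
  have hT := measurable_comp_iso e
  have hint : ∀ f : (V → Bool) → ℝ, IsBddOn Set.univ f →
      ∫ φ, f φ ∂(ν.map fun φ v => φ (e v)) = ∫ φ, f (fun v => φ (e v)) ∂ν := fun f hf =>
    integral_map hT.aemeasurable hf.measurable.aestronglyMeasurable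
  have hspin : ∀ u a (φ : V → Bool), spin u a (fun v => φ (e v)) = spin (e u) a φ :=
    fun _ _ _ => rfl
  have hs : ∀ (u : V) a, IsBddOn Set.univ (spin u a) := fun u a => isBddOn_spin (Set.mem_univ u) a
  refine IsChain.eq hG hq hq2 (μ := ν.map fun φ v => φ (e v)) ⟨?_, ?_, ?_⟩ hν how
  · exact Measure.isProbabilityMeasure_map hT.aemeasurable
  · intro u w huw
    rw [ae_map_iff hT.aemeasurable]
    · exact hν.isHardCore (e u) (e w) (e.map_rel_iff.mpr huw)
    · exact measurableSet_eq_fun ((hs u true).mul (hs w true)).measurable measurable_const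
  · intro u w huw g hg
    have hg' := hg.mono (Set.subset_univ _)
    rw [hint _ ((hs u false).mul ((hs w false).mul hg')), hint _ ((hs u false).mul hg')]
    simp only [hspin]
    refine hν.transition (e u) (e w) (e.map_rel_iff.mpr huw) _ (hg.comp hT fun v hv φ ψ h => ?_)
    exact h (e v) fun hv' => hv ((mem_branch_iso e u w v).mp hv')

/-- Conditional independence reduces the transition identity to `g = 1`. If `u` is occupied then `w`
is vacant, so both are vacant with probability π₀ - (1 - π₀). -/
lemma IsSimple.isChain (hG : G.IsTree) [IsProbabilityMeasure ν] (hν : IsSimple G ν)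
    (hc : IsHardCore G ν) {π₀ : ℝ} (hπ : ∀ u, ∫ φ, vac u φ ∂ν = π₀) (hπ0 : π₀ ≠ 0)
    (hq : q * π₀ = 2 * π₀ - 1) : IsChain G q ν := by
  refine ⟨inferInstance, hc, fun u w huw g hg => ?_⟩
  have hw : IsBddOn (branch G u w) (vac w) := isBddOn_spin (mem_branch_right huw) false
  have h1 := hν.integral_mul hG huw false hw hg
  have h2 := (hw.mono (Set.subset_univ _)).integral_eq_add ν u
  have h3 := hc.integral_occ_mul huw (fun _ => 1)
  simp only [mul_one] at h3
  have h4 := HardCore.integral_vac ν u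
  have h5 : ∫ φ, vac u φ * vac w φ ∂ν = q * π₀ := by
    rw [hπ] at h2 h4
    linarith
  rw [h5, hπ] at h1
  exact mul_right_cancel₀ hπ0 (h1.trans (by ring))

variable [G.LocallyFinite]

lemma IsChain.integral_vac_mul_prod (hG : G.IsTree) (h : IsChain G q ν) (u : V) (T : Finset V)
    (hT : T ⊆ G.neighborFinset u) :
    ∫ φ, vac u φ * ∏ w ∈ T, vac w φ ∂ν = q ^ T.card * ∫ φ, vac u φ ∂ν := by
  classical
  induction T using Finset.induction_on with
  | empty => simp
  | insert w T hw ih =>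
    have huw : G.Adj u w := (G.mem_neighborFinset u w).mp (hT (Finset.mem_insert_self w T))
    have hb : IsBddOn (branch G u w)ᶜ (fun φ => ∏ w ∈ T, vac w φ) := by
      refine IsBddOn.prod _ fun z hz => isBddOn_spin (fun hmem => ?_) false
      have huz : G.Adj u z :=
        (G.mem_neighborFinset u z).mp (hT (Finset.mem_insert_of_mem hz))
      exact hw (eq_of_mem_branch hG huz huw (mem_branch_right huz) hmem ▸ hz)
    simp only [Finset.prod_insert hw]
    rw [h.transition u w huw _ hb, ih fun z hz => hT (Finset.mem_insert_of_mem hz),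
      Finset.card_insert_of_notMem hw]
    ring

lemma IsSimpleInvariantGibbs.isChain (hG : G.IsTree) {k : ℕ}
    (hreg : G.IsRegularOfDegree (k + 1)) (hlam : 0 < lam) (hp : p ≤ 1)
    (hpl : p = lam * (1 - p) ^ (k + 1)) (hν : IsSimpleInvariantGibbs G lam ν) :
    IsChain G (1 - p) ν := by
  have := countable_of_isTree hG
  have := hν.isGibbs.isProbabilityMeasure
  obtain ⟨o⟩ := hG.connected.nonempty
  have hs : ∀ (u : V) a, IsBddOn Set.univ (spin u a) := fun u a => isBddOn_spin (Set.mem_univ u) a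
  set π₀ := ∫ φ, vac o φ ∂ν with hπ₀
  have hπ : ∀ u, ∫ φ, vac u φ ∂ν = π₀ := by
    intro u
    obtain ⟨e, he⟩ := exists_iso_apply_eq hG hreg o u
    rw [hπ₀, ← hν.isInvariant e, integral_map (measurable_comp_iso e).aemeasurable
      (hs o false).measurable.aestronglyMeasurable, hν.isInvariant e, ← he]
    rfl
  have hocc : ∫ φ, occ o φ ∂ν = 1 - π₀ := by
    rw [hπ₀, HardCore.integral_vac]
    ring
  have hG1 : 1 - π₀ = lam * ∫ φ, vac o φ * vacNbr G o φ ∂ν := by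
    have := hν.isGibbs.integral_occ_mul hlam o (isBddOn_const 1)
    simpa only [mul_one, hocc] using this
  have hN : IsBddOn Set.univ (vacNbr G o) := (isBddOn_vacNbr o).mono (Set.subset_univ _)
  have hle : ∫ φ, vac o φ * vacNbr G o φ ∂ν ≤ π₀ := by
    refine integral_mono (((hs o false).mul hN).integrable ν) ((hs o false).integrable ν)
      fun φ => ?_
    have h1 : vacNbr G o φ ≤ 1 :=
      Finset.prod_le_one (fun w _ => spin_nonneg _ _ _) fun w _ => spin_le_one _ _ _
    exact mul_le_of_le_one_right (spin_nonneg _ _ _) h1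
  -- From 1 - π₀ ≤ λπ₀.
  have hpos : 0 < π₀ := by nlinarith
  have hchain : IsChain G (2 - π₀⁻¹) ν := by
    refine hν.isSimple.isChain hG hν.isGibbs.isHardCore hπ hpos.ne' ?_
    field_simp
  have hprod := hchain.integral_vac_mul_prod hG o _ subset_rfl
  rw [G.card_neighborFinset_eq_degree, hreg.degree_eq o] at hprod
  -- This puts 1/π₀ - 1 in the range p ≤ 1, where the fixed point equation has one solution.
  have hq0 : 0 ≤ 2 - π₀⁻¹ := by
    obtain ⟨w, hw⟩ : ∃ w, G.Adj o w := by
      have : 0 < G.degree o := by rw [hreg.degree_eq o]; omega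
      exact (G.degree_pos_iff_exists_adj o).mp this
    have := hchain.transition o w hw _ (isBddOn_const 1)
    simp only [mul_one, hπ] at this
    have h0 : 0 ≤ ∫ φ, vac o φ * vac w φ ∂ν :=
      integral_nonneg fun φ => mul_nonneg (spin_nonneg _ _ _) (spin_nonneg _ _ _)
    rw [this] at h0
    exact nonneg_of_mul_nonneg_left h0 hpos
  have hp' : π₀⁻¹ - 1 = p := by
    refine eq_of_eq_mul_one_sub_pow hlam (by linarith) hp ?_ hpl
    have e1 : 1 - (π₀⁻¹ - 1) = 2 - π₀⁻¹ := by ring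
    rw [e1]
    have e2 : 1 - π₀ = lam * ((2 - π₀⁻¹) ^ (k + 1) * π₀) := by
      rw [hG1]; congr 1
    have e3 : π₀⁻¹ - 1 = (1 - π₀) * π₀⁻¹ := by field_simp
    rw [e3, e2]
    field_simp
  have : 1 - p = 2 - π₀⁻¹ := by rw [← hp']; ring
  rwa [this]

end Chain

/-! ### Second moment of the posterior and extremality -/

section Extremal

variable {V : Type*} {G : SimpleGraph V} {μ ν : Measure (V → Bool)} {f g : (V → Bool) → ℝ}
  {lam p q : ℝ}

/-- The edge is read backwards: an occupied `w` forces `z` vacant, and from a vacant `z` the chain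
moves to an occupied `w` with probability `1 - q`, whatever happens beyond `z`. -/
lemma IsChain.integral_occ_mul (hG : G.IsTree) (h : IsChain G q μ) {w z : V} (hwz : G.Adj w z)
    (hf : IsBddOn (branch G w z) f) :
    ∫ φ, occ w φ * f φ ∂μ = (1 - q) * ∫ φ, vac z φ * f φ ∂μ := by
  have := h.isProbabilityMeasure
  have hf' : IsBddOn (branch G z w)ᶜ f := by rwa [compl_branch hG hwz.symm]
  have h1 := h.transition z w hwz.symm f hf'
  have h2 := h.isHardCore.integral_occ_mul hwz f
  have hz : IsBddOn Set.univ (fun φ => vac z φ * f φ) :=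
    (isBddOn_spin (Set.mem_univ z) false).mul (hf.mono (Set.subset_univ _))
  have h3 := hz.integral_eq_add μ w
  have h4 : ∫ φ, vac w φ * (vac z φ * f φ) ∂μ = q * ∫ φ, vac z φ * f φ ∂μ := by
    rw [← h1]
    congr 1
    funext φ
    ring
  rw [h2, h4] at h3
  linarith

variable [G.LocallyFinite]

/-- Given that `w` is occupied, the branches at `w` are independent, and each factor has the mean it
has given that its own vertex `z` is vacant, at most `S`. -/
lemma IsChain.integral_occ_mul_prod_posterior_le (hG : G.IsTree) (hlam : 0 < lam)
    (hs : IsSimple G μ) (h : IsChain G q μ) (hq : q < 1) {π₀ S : ℝ} (hπ : 0 < π₀)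
    (hπ₀ : ∀ u, ∫ φ, occ u φ ∂μ = (1 - q) * π₀) (n : ℕ)
    (hS : ∀ u w, G.Adj u w → ∫ φ, vac w φ * posterior G lam n u w φ ∂μ ≤ π₀ * S) (w : V)
    (T : Finset V) (hT : T ⊆ G.neighborFinset w) :
    ∫ φ, occ w φ * ∏ z ∈ T, posterior G lam n w z φ ∂μ ≤ (1 - q) * π₀ * S ^ T.card := by
  classical
  have := h.isProbabilityMeasure
  have hp : 0 < 1 - q := by linarith
  induction T using Finset.induction_on with
  | empty => simp [hπ₀]
  | insert z T hz ih =>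
    have hT' : T ⊆ G.neighborFinset w := fun x hx => hT (Finset.mem_insert_of_mem hx)
    have hwz : G.Adj w z := (G.mem_neighborFinset w z).mp (hT (Finset.mem_insert_self z T))
    have hbz : IsBddOn (branch G w z) (posterior G lam n w z) :=
      (isBddOn_posterior hG hlam n hwz).mono Set.sdiff_subset
    have hbT : IsBddOn (branch G w z)ᶜ (fun φ => ∏ z ∈ T, posterior G lam n w z φ) := by
      refine IsBddOn.prod _ fun x hx => ?_
      have hwx : G.Adj w x := (G.mem_neighborFinset w x).mp (hT' hx)
      refine (isBddOn_posterior hG hlam n hwx).mono fun y hy hy' => hz ?_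
      exact eq_of_mem_branch hG hwx hwz hy.1 hy' ▸ hx
    have hind := hs.integral_mul hG hwz true hbz hbT
    have h1 : ∫ φ, occ w φ * posterior G lam n w z φ ∂μ ≤ (1 - q) * π₀ * S := by
      rw [h.integral_occ_mul hG hwz hbz, mul_assoc]
      exact mul_le_mul_of_nonneg_left (hS w z hwz) hp.le
    have h10 : 0 ≤ ∫ φ, occ w φ * posterior G lam n w z φ ∂μ :=
      integral_nonneg fun φ => mul_nonneg (spin_nonneg _ _ _) (posterior_nonneg hlam _ _ _ _)
    have h20 : 0 ≤ ∫ φ, occ w φ * ∏ z ∈ T, posterior G lam n w z φ ∂μ :=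
      integral_nonneg fun φ => mul_nonneg (spin_nonneg _ _ _)
        (Finset.prod_nonneg fun z _ => posterior_nonneg hlam _ _ _ _)
    simp only [Finset.prod_insert hz, Finset.card_insert_of_notMem hz]
    have h3 := mul_le_mul h1 (ih hT') h20 (h10.trans h1)
    rw [← hind, hπ₀] at h3
    have h4 : (1 - q) * π₀ * S * ((1 - q) * π₀ * S ^ T.card) =
        (1 - q) * π₀ * S ^ (T.card + 1) * ((1 - q) * π₀) := by ring
    rw [h4] at h3
    exact le_of_mul_le_mul_right h3 (by positivity)

/-- The mean of the posterior over the event `u` vacant is known, namely q π₀. It splits into `w`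
vacant and `w` occupied, so a lower bound on the occupied part, obtained from Jensen's inequality
for 1/(1 + R), is an upper bound on the vacant part. -/
lemma IsChain.integral_vac_mul_posterior_le (hG : G.IsTree) {k : ℕ}
    (hreg : G.IsRegularOfDegree (k + 1)) (hlam : 0 < lam) (hs : IsSimple G μ)
    (hgibbs : IsGibbs G lam μ) (h : IsChain G q μ) (hq0 : 0 < q) (hq : q < 1) {π₀ : ℝ}
    (hπ : 0 < π₀) (hvac : ∀ u, ∫ φ, vac u φ ∂μ = π₀)
    (hocc : ∀ u, ∫ φ, occ u φ ∂μ = (1 - q) * π₀) (n : ℕ) (u w : V) (huw : G.Adj u w) :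
    ∫ φ, vac w φ * posterior G lam n u w φ ∂μ ≤ π₀ * momentBound k ((1 - q) / q) lam n := by
  classical
  have := h.isProbabilityMeasure
  have hp : 0 < 1 - q := by linarith
  induction n generalizing u w with
  | zero => simp [posterior, spin_mul_self, momentBound, hvac]
  | succ n ih =>
    set S := momentBound k ((1 - q) / q) lam n with hS
    set Q := posterior G lam (n + 1) u w with hQ
    set R : (V → Bool) → ℝ := fun φ =>
      lam * ∏ z ∈ (G.neighborFinset w).erase u, posterior G lam n w z φ with hR
    have hS0 : 0 ≤ S := by
      have h0 : 0 ≤ ∫ φ, vac w φ * posterior G lam n u w φ ∂μ :=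
        integral_nonneg fun φ => mul_nonneg (spin_nonneg _ _ _) (posterior_nonneg hlam _ _ _ _)
      exact nonneg_of_mul_nonneg_right (h0.trans (ih u w huw)) hπ
    have hQb : IsBddOn (branch G u w) Q :=
      (isBddOn_posterior hG hlam (n + 1) huw).mono Set.sdiff_subset
    have hRb : IsBddOn Set.univ R := by
      refine IsBddOn.const_mul (IsBddOn.prod _ fun z hz => ?_) lam
      exact (isBddOn_posterior hG hlam n ((G.mem_neighborFinset w z).mp
        (Finset.mem_of_mem_erase hz))).mono (Set.subset_univ _)
    have hob : IsBddOn Set.univ (occ w) := isBddOn_spin (Set.mem_univ w) true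
    have hQu := hQb.mono (Set.subset_univ _)
    have hR0 : ∀ φ, 0 ≤ R φ := fun φ =>
      mul_nonneg hlam.le (Finset.prod_nonneg fun z _ => posterior_nonneg hlam _ _ _ _)
    have hQR : ∀ φ, Q φ = (1 + R φ)⁻¹ := fun φ => rfl
    set ρ := lam * S ^ k with hρ
    have hρ0 : 0 ≤ ρ := by positivity
    have hcard : ((G.neighborFinset w).erase u).card = k := by
      rw [Finset.card_erase_of_mem ((G.mem_neighborFinset w u).mpr huw.symm),
        G.card_neighborFinset_eq_degree, hreg.degree_eq w]
      rfl
    have hRle : ∫ φ, occ w φ * R φ ∂μ ≤ (1 - q) * π₀ * ρ := by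
      have h1 := h.integral_occ_mul_prod_posterior_le hG hlam hs hq hπ hocc n ih w
        ((G.neighborFinset w).erase u) (Finset.erase_subset _ _)
      rw [hcard] at h1
      have h2 := mul_le_mul_of_nonneg_left h1 hlam.le
      rw [← integral_const_mul] at h2
      calc _ = ∫ φ, lam * (occ w φ * ∏ z ∈ (G.neighborFinset w).erase u,
            posterior G lam n w z φ) ∂μ := by
              congr 1; funext φ; rw [hR]; ring
        _ ≤ _ := h2.trans (le_of_eq (by rw [hρ]; ring))
    -- Tangent line of the convex function 1/(1 + R) at `R = ρ`, the bound for the mean of `R` given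
    -- `w` occupied.
    have htan : ∀ φ, occ w φ * ((1 + ρ)⁻¹ + ρ * ((1 + ρ)⁻¹) ^ 2) - ((1 + ρ)⁻¹) ^ 2 * (occ w φ * R φ)
        ≤ occ w φ * Q φ := by
      intro φ
      have h1 : (1 + ρ)⁻¹ + ρ * ((1 + ρ)⁻¹) ^ 2 - ((1 + ρ)⁻¹) ^ 2 * R φ ≤ Q φ := by
        rw [hQR]
        have := hR0 φ
        rw [← sub_nonneg]
        have e : (1 + R φ)⁻¹ - ((1 + ρ)⁻¹ + ρ * ((1 + ρ)⁻¹) ^ 2 - ((1 + ρ)⁻¹) ^ 2 * R φ) =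
            (R φ - ρ) ^ 2 * ((1 + ρ)⁻¹) ^ 2 * (1 + R φ)⁻¹ := by
          field_simp
          ring
        rw [e]
        positivity
      calc _ = occ w φ * ((1 + ρ)⁻¹ + ρ * ((1 + ρ)⁻¹) ^ 2 - ((1 + ρ)⁻¹) ^ 2 * R φ) := by ring
        _ ≤ _ := mul_le_mul_of_nonneg_left h1 (spin_nonneg _ _ _)
    have hoR := hob.mul hRb
    have hint := integral_mono (μ := μ)
      (((hob.mul (isBddOn_const ((1 + ρ)⁻¹ + ρ * ((1 + ρ)⁻¹) ^ 2))).sub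
        (hoR.const_mul (((1 + ρ)⁻¹) ^ 2))).integrable μ) ((hob.mul hQu).integrable μ) htan
    rw [integral_sub ((hob.mul (isBddOn_const _)).integrable μ)
      ((hoR.const_mul _).integrable μ), integral_mul_const, integral_const_mul, hocc] at hint
    have hoccQ : (1 - q) * π₀ * (1 + ρ)⁻¹ ≤ ∫ φ, occ w φ * Q φ ∂μ := by
      have := mul_le_mul_of_nonneg_left hRle (sq_nonneg ((1 + ρ)⁻¹))
      linarith
    have h1 := hgibbs.integral_vac_mul_vac_mul hG hlam (n + 1) huw (isBddOn_const 1)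
    have h2 := h.transition u w huw _ (isBddOn_const 1)
    simp only [mul_one] at h1 h2
    rw [h2, hvac] at h1
    have huQ : IsBddOn Set.univ (fun φ => vac u φ * Q φ) :=
      (isBddOn_spin (Set.mem_univ u) false).mul hQu
    have h3 := huQ.integral_eq_add μ w
    have h4 : ∫ φ, vac w φ * (vac u φ * Q φ) ∂μ = q * ∫ φ, vac w φ * Q φ ∂μ :=
      h.transition w u huw.symm Q (by rwa [compl_branch hG huw.symm])
    have h5 := h.isHardCore.integral_occ_mul huw.symm Q
    rw [h4, h5, ← h1] at h3
    have h6 : ∫ φ, vac w φ * Q φ ∂μ = π₀ - (∫ φ, occ w φ * Q φ ∂μ) / q := by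
      field_simp
      linarith
    rw [h6]
    have h7 := div_le_div_of_nonneg_right hoccQ hq0.le
    calc _ ≤ π₀ - (1 - q) * π₀ * (1 + ρ)⁻¹ / q := by linarith
      _ = π₀ * (1 - (1 - q) / q / (1 + lam * S ^ k)) := by
        rw [hρ]; field_simp
      _ = _ := by rw [momentBound]

/-- Testing the posterior property on the posterior itself turns its square into `vac w` times it;
the transition from `w` to `u` then produces the factor `q`. -/
lemma IsChain.integral_vac_mul_sq_posterior_sub (hG : G.IsTree) (hlam : 0 < lam)
    (hgibbs : IsGibbs G lam μ) (h : IsChain G q μ) {π₀ : ℝ}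
    (hvac : ∀ u, ∫ φ, vac u φ ∂μ = π₀) (n : ℕ) {u w : V} (huw : G.Adj u w) :
    ∫ φ, vac u φ * (posterior G lam n u w φ - q) ^ 2 ∂μ =
      q * (∫ φ, vac w φ * posterior G lam n u w φ ∂μ) - q ^ 2 * π₀ := by
  have := h.isProbabilityMeasure
  set Q := posterior G lam n u w with hQ
  have hQb : IsBddOn (branch G u w) Q :=
    (isBddOn_posterior hG hlam n huw).mono Set.sdiff_subset
  have hQu := hQb.mono (Set.subset_univ _)
  have hub : IsBddOn Set.univ (vac u) := isBddOn_spin (Set.mem_univ u) false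
  have h1 := hgibbs.integral_vac_mul_vac_mul hG hlam n huw (isBddOn_const 1)
  have h2 := h.transition u w huw _ (isBddOn_const 1)
  simp only [mul_one] at h1 h2
  rw [h2, hvac] at h1
  have h3 := hgibbs.integral_vac_mul_vac_mul hG hlam n huw (isBddOn_compl_posterior hG hlam n huw)
  have h4 : ∫ φ, vac w φ * (vac u φ * Q φ) ∂μ = q * ∫ φ, vac w φ * Q φ ∂μ :=
    h.transition w u huw.symm Q (by rwa [compl_branch hG huw.symm])
  have h5 : ∫ φ, vac u φ * (vac w φ * Q φ) ∂μ = ∫ φ, vac w φ * (vac u φ * Q φ) ∂μ := by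
    congr 1; funext φ; ring
  rw [← hQ] at h1 h3
  rw [h5, h4] at h3
  have hA := hub.mul (hQu.mul hQu)
  have hB := (hub.mul hQu).const_mul (2 * q)
  have hC := hub.const_mul (q ^ 2)
  calc _ = ∫ φ, vac u φ * (Q φ * Q φ) - 2 * q * (vac u φ * Q φ) + q ^ 2 * vac u φ ∂μ := by
        congr 1; funext φ; ring
    _ = _ := by
        rw [integral_add ((hA.sub hB).integrable μ) (hC.integrable μ),
          integral_sub (hA.integrable μ) (hB.integrable μ), integral_const_mul,
          integral_const_mul, ← h3, ← h1, hvac]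
        ring

/-- A Gibbs measure that is dominated by a simple chain for which the posterior probabilities
converge is the law of a chain with the same transition probability. -/
lemma IsGibbs.isChain_of_le (hG : G.IsTree) {k : ℕ} (hk : 1 ≤ k)
    (hreg : G.IsRegularOfDegree (k + 1)) (hlam : 0 < lam) (hlam' : lam ≤ Real.exp 1 - 1)
    (hp0 : 0 < p) (hp1 : p < 1) (hpl : p = lam * (1 - p) ^ (k + 1)) (hs : IsSimple G μ)
    (hgibbs : IsGibbs G lam μ) (h : IsChain G (1 - p) μ) (hν : IsGibbs G lam ν) {c : ℝ≥0∞}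
    (hc : c ≠ ∞) (hle : ν ≤ c • μ) : IsChain G (1 - p) ν := by
  have := countable_of_isTree hG
  have := h.isProbabilityMeasure
  have := hν.isProbabilityMeasure
  refine ⟨inferInstance, hν.isHardCore, fun u w huw g hg => ?_⟩
  set q := 1 - p with hq
  have hq0 : 0 < q := by linarith
  have hq1 : q < 1 := by linarith
  have hvac : ∀ v, ∫ φ, vac v φ ∂μ = (1 + p)⁻¹ := by
    intro v
    obtain ⟨z, hz⟩ : ∃ z, G.Adj v z := by
      have : 0 < G.degree v := by rw [hreg.degree_eq v]; omega
      exact (G.degree_pos_iff_exists_adj v).mp this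
    rw [h.integral_vac hq0.ne' (by linarith) hz]
    congr 1
    rw [hq]; ring
  have hocc : ∀ v, ∫ φ, occ v φ ∂μ = (1 - q) * (1 + p)⁻¹ := by
    intro v
    have h1 := HardCore.integral_vac μ v
    rw [hvac] at h1
    have h2 : ∫ φ, occ v φ ∂μ = 1 - (1 + p)⁻¹ := by linarith
    rw [h2, hq]
    field_simp
    ring
  -- With x = p/q one has 1 + x = 1/q, so this is the equation p = λ q^(k+1).
  have hx : (1 - q) / q * (1 + (1 - q) / q) ^ k = lam := by
    have e1 : 1 + (1 - q) / q = q⁻¹ := by field_simp; ring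
    have e2 : 1 - q = lam * q ^ (k + 1) := by rw [← hpl, hq]; ring
    rw [e1, e2, inv_pow, pow_succ]
    field_simp
  have hlim := tendsto_momentBound hk (x := (1 - q) / q) (div_pos (by linarith) hq0) hx hlam'
  have hlimq : (1 + (1 - q) / q)⁻¹ = q := by field_simp; ring
  rw [hlimq] at hlim
  set π₀ := (1 + p)⁻¹ with hπ₀
  have hπ : 0 < π₀ := by positivity
  set δ : ℕ → ℝ := fun n => q * (π₀ * momentBound k ((1 - q) / q) lam n) - q ^ 2 * π₀ with hδ
  have hδlim : Filter.Tendsto δ Filter.atTop (nhds 0) := by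
    have := ((hlim.const_mul π₀).const_mul q).sub_const (q ^ 2 * π₀)
    have e : q * (π₀ * q) - q ^ 2 * π₀ = 0 := by ring
    rwa [e] at this
  obtain ⟨C, hC⟩ := hg.bounded
  have hC0 : 0 ≤ C := (abs_nonneg _).trans (hC fun _ => false)
  have hub : IsBddOn Set.univ (vac u) := isBddOn_spin (Set.mem_univ u) false
  have hgu := hg.mono (Set.subset_univ _)
  set D := ∫ φ, vac u φ * (vac w φ * g φ) ∂ν - q * ∫ φ, vac u φ * g φ ∂ν with hD
  -- `D` is the defect of the transition identity for `ν`. Being Gibbs, `ν` has the same posterior,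
  -- so `D` integrates (Q - q)g over `u` vacant; domination by `c • μ` bounds the second moment of Q
  -- - q.
  have key : ∀ ε : ℝ, 0 < ε → ∀ n, |D| ≤ C * ε + C / ε * (c.toReal * δ n) := by
    intro ε hε n
    set Q := posterior G lam n u w with hQ
    have hQb : IsBddOn (branch G u w) Q :=
      (isBddOn_posterior hG hlam n huw).mono Set.sdiff_subset
    have hQu := hQb.mono (Set.subset_univ _)
    have hYb : IsBddOn Set.univ (fun φ => vac u φ * (Q φ - q) ^ 2) := by
      have h1 := hQu.sub (isBddOn_const q)
      simpa only [sq] using hub.mul (h1.mul h1)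
    have h1 : ∫ φ, vac u φ * (Q φ - q) ^ 2 ∂ν ≤ c.toReal * δ n := by
      have hb : Integrable (fun φ => vac u φ * (Q φ - q) ^ 2) (c • μ) :=
        (hYb.integrable μ).smul_measure hc
      refine (integral_mono_measure hle (ae_of_all _ fun φ =>
        mul_nonneg (spin_nonneg _ _ _) (sq_nonneg _)) hb).trans ?_
      rw [integral_smul_measure, smul_eq_mul]
      refine mul_le_mul_of_nonneg_left ?_ ENNReal.toReal_nonneg
      rw [h.integral_vac_mul_sq_posterior_sub hG hlam hgibbs hvac n huw]
      have := h.integral_vac_mul_posterior_le hG hreg hlam hs hgibbs hq0 hq1 hπ hvac hocc n u w huw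
      have := mul_le_mul_of_nonneg_left this hq0.le
      rw [hδ]
      linarith
    have h2 : D = ∫ φ, vac u φ * ((Q φ - q) * g φ) ∂ν := by
      have hgI : IsBddOn (initialBranch G n u w)ᶜ g :=
        hg.mono (Set.compl_subset_compl.mpr (initialBranch_subset hG n huw))
      rw [hD, hν.integral_vac_mul_vac_mul hG hlam n huw hgI, ← integral_const_mul,
        ← integral_sub ((hub.mul (hQu.mul hgu)).integrable ν)
          (((hub.mul hgu).const_mul q).integrable ν)]
      congr 1; funext φ; ring
    rw [h2]
    calc |∫ φ, vac u φ * ((Q φ - q) * g φ) ∂ν|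
        ≤ ∫ φ, C * ε + C / ε * (vac u φ * (Q φ - q) ^ 2) ∂ν := by
          rw [← Real.norm_eq_abs]
          refine norm_integral_le_of_norm_le
            (((isBddOn_const (s := Set.univ) (C * ε)).add (hYb.const_mul (C / ε))).integrable ν)
            (ae_of_all _ fun φ => ?_)
          rw [Real.norm_eq_abs, abs_mul, abs_mul, abs_of_nonneg (spin_nonneg u false φ)]
          have hv0 := spin_nonneg u false φ
          have hv1 := spin_le_one u false φ
          -- A linear-quadratic bound in place of the Cauchy–Schwarz inequality; `n` tends to
          -- infinity before `ε` tends to 0.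
          have hy : |Q φ - q| ≤ ε + (Q φ - q) ^ 2 / ε := by
            rw [← sq_abs (Q φ - q)]
            set y := |Q φ - q|
            have : ε + y ^ 2 / ε - y = ((y - ε / 2) ^ 2 + 3 / 4 * ε ^ 2) / ε := by
              field_simp
              ring
            have h0 : 0 ≤ ((y - ε / 2) ^ 2 + 3 / 4 * ε ^ 2) / ε := by positivity
            linarith
          calc vac u φ * (|Q φ - q| * |g φ|) ≤ vac u φ * ((ε + (Q φ - q) ^ 2 / ε) * C) := by
                refine mul_le_mul_of_nonneg_left ?_ hv0
                exact mul_le_mul hy (hC φ) (abs_nonneg _) (by positivity)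
            _ = C * ε * vac u φ + C / ε * (vac u φ * (Q φ - q) ^ 2) := by ring
            _ ≤ _ := by
                have : C * ε * vac u φ ≤ C * ε := mul_le_of_le_one_right (by positivity) hv1
                linarith
      _ = C * ε + C / ε * ∫ φ, vac u φ * (Q φ - q) ^ 2 ∂ν := by
          rw [integral_add (integrable_const _) ((hYb.const_mul _).integrable ν),
            integral_const_mul (C / ε)]
          simp
      _ ≤ _ := by
          have := mul_le_mul_of_nonneg_left h1 (by positivity : 0 ≤ C / ε)
          linarith
  have key2 : ∀ ε : ℝ, 0 < ε → |D| ≤ C * ε := by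
    intro ε hε
    have := ((hδlim.const_mul c.toReal).const_mul (C / ε)).const_add (C * ε)
    rw [mul_zero, mul_zero, add_zero] at this
    exact ge_of_tendsto' this (key ε hε)
  have hD0 : |D| ≤ 0 := by
    refine le_of_forall_pos_le_add fun ε hε => ?_
    have := key2 (ε / (C + 1)) (by positivity)
    refine this.trans ?_
    rw [zero_add, ← mul_div_assoc, div_le_iff₀ (by positivity)]
    nlinarith
  exact sub_eq_zero.mp (abs_nonpos_iff.mp hD0)

lemma IsSimpleInvariantGibbs.isExtremalGibbs (hG : G.IsTree) {k : ℕ} (hk : 1 ≤ k)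
    (hreg : G.IsRegularOfDegree (k + 1)) (hlam : 0 < lam) (hlam' : lam ≤ Real.exp 1 - 1)
    (hμ : IsSimpleInvariantGibbs G lam μ) : IsExtremalGibbs G lam μ := by
  obtain ⟨p, hp0, hp1, hpl⟩ := exists_eq_mul_one_sub_pow k hlam
  have hchain := hμ.isChain hG hreg hlam hp1.le hpl
  refine ⟨hμ.isGibbs, ?_⟩
  rintro ν hν ν' hν' ⟨a, b, ha, hb, hab, rfl⟩
  have hatop : a ≠ ∞ := fun h => by simp [h] at hab
  obtain ⟨o⟩ := hG.connected.nonempty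
  obtain ⟨z, hz⟩ : ∃ z, G.Adj o z := by
    have : 0 < G.degree o := by rw [hreg.degree_eq o]; omega
    exact (G.degree_pos_iff_exists_adj o).mp this
  have hle : ν ≤ a⁻¹ • (a • ν + b • ν') := by
    rw [smul_add, smul_smul, ENNReal.inv_mul_cancel ha.ne' hatop, one_smul]
    exact Measure.le_add_right le_rfl
  have hchain' := IsGibbs.isChain_of_le hG hk hreg hlam hlam' hp0 hp1 hpl hμ.isSimple hμ.isGibbs
    hchain hν (ENNReal.inv_ne_top.mpr ha.ne') hle
  exact hchain'.eq hG (by linarith) (by linarith) hchain hz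

end Extremal

/-! ### Simple chains are Gibbs measures -/

section GibbsOfChain

variable {V : Type*} {G : SimpleGraph V} [G.LocallyFinite] {ν : Measure (V → Bool)} {lam p : ℝ}

/-- Conditioning on `u` factorises both integrals over the branches. Each branch contributes the
same mean of `vac w * f w` on both sides, with an additional factor `1 - p` when `u` is vacant. -/
lemma IsSimple.integral_occ_mul_prod (hG : G.IsTree) (hs : IsSimple G ν)
    (h : IsChain G (1 - p) ν) {π₀ : ℝ} (hp : p ≠ 0) (hπ : π₀ ≠ 0)
    (hvac : ∀ u, ∫ φ, vac u φ ∂ν = π₀) (hocc : ∀ u, ∫ φ, occ u φ ∂ν = p * π₀) (u : V)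
    (f : V → (V → Bool) → ℝ) (hf : ∀ w, IsBddOn (branch G u w) (f w)) (T : Finset V)
    (hT : T ⊆ G.neighborFinset u) :
    (1 - p) ^ T.card * ∫ φ, occ u φ * ∏ w ∈ T, f w φ ∂ν =
      p * ∫ φ, vac u φ * ∏ w ∈ T, (vac w φ * f w φ) ∂ν := by
  classical
  have := h.isProbabilityMeasure
  induction T using Finset.induction_on with
  | empty => simp [hvac, hocc]
  | insert w T hw ih =>
    have ih' := ih fun z hz => hT (Finset.mem_insert_of_mem hz)
    have huw : G.Adj u w := (G.mem_neighborFinset u w).mp (hT (Finset.mem_insert_self w T))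
    have hsub : ∀ z ∈ T, G.Adj u z ∧ branch G u z ⊆ (branch G u w)ᶜ := by
      intro z hz
      have huz : G.Adj u z :=
        (G.mem_neighborFinset u z).mp (hT (Finset.mem_insert_of_mem hz))
      exact ⟨huz, fun y hy hy' => hw (eq_of_mem_branch hG huz huw hy hy' ▸ hz)⟩
    have hwf : IsBddOn (branch G u w) (fun φ => vac w φ * f w φ) :=
      (isBddOn_spin (mem_branch_right huw) false).mul (hf w)
    have h1 := hs.integral_mul hG huw true (hf w) (g := fun φ => ∏ w ∈ T, f w φ)
      (IsBddOn.prod _ fun z hz => (hf z).mono (hsub z hz).2)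
    have h2 := hs.integral_mul hG huw false hwf (g := fun φ => ∏ w ∈ T, (vac w φ * f w φ))
      (IsBddOn.prod _ fun z hz => ((isBddOn_spin (mem_branch_right (hsub z hz).1) false).mul
        (hf z)).mono (hsub z hz).2)
    have h3 := h.integral_occ_mul hG huw (hf w)
    have h4 := h.transition w u huw.symm (f w) (by rw [compl_branch hG huw.symm]; exact hf w)
    have h5 : ∫ φ, vac u φ * (vac w φ * f w φ) ∂ν = ∫ φ, vac w φ * (vac u φ * f w φ) ∂ν := by
      congr 1; funext φ; ring
    rw [h5, h4, hvac] at h2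
    rw [h3, hocc] at h1
    simp only [Finset.prod_insert hw, Finset.card_insert_of_notMem hw]
    set X := ∫ φ, vac w φ * f w φ ∂ν
    have e1 : (∫ φ, occ u φ * (f w φ * ∏ w ∈ T, f w φ) ∂ν) * π₀ =
        X * ∫ φ, occ u φ * ∏ w ∈ T, f w φ ∂ν := by
      refine mul_left_cancel₀ hp ?_
      linear_combination h1
    refine mul_right_cancel₀ hπ ?_
    linear_combination (1 - p) ^ (T.card + 1) * e1 - p * h2 + (1 - p) * X * ih'

lemma prod_vac_eq_indicator (S : Finset V) : (fun φ => ∏ v ∈ S, vac v φ) =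
    {φ : V → Bool | ∀ v ∈ S, φ v = false}.indicator fun _ => (1 : ℝ) := by
  funext φ
  by_cases h : ∀ v ∈ S, φ v = false
  · rw [Set.indicator_of_mem (by exact h)]
    exact Finset.prod_eq_one fun v hv => by simp [spin, h v hv]
  · rw [Set.indicator_of_notMem (by exact h)]
    push Not at h
    obtain ⟨v, hv, hφ⟩ := h
    exact Finset.prod_eq_zero hv (by simp [spin, hφ])

lemma measurableSet_forall_vacant (s : Set V) (S : Finset V) (hS : ↑S ⊆ s) :
    MeasurableSet[cylinderEvents (X := fun _ : V => Bool) s]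
      {φ : V → Bool | ∀ v ∈ S, φ v = false} := by
  have : {φ : V → Bool | ∀ v ∈ S, φ v = false} = ⋂ v ∈ S, {φ : V → Bool | φ v = false} := by
    ext; simp
  rw [this]
  exact Finset.measurableSet_biInter _ fun v hv =>
    measurable_cylinderEvent_apply (X := fun _ : V => Bool) (Δ := s) (hS hv)
      (measurableSet_singleton false)

lemma cylinderEvents_eq_generateFrom (s : Set V) : cylinderEvents (X := fun _ : V => Bool) s =
    MeasurableSpace.generateFrom
      {B | ∃ S : Finset V, ↑S ⊆ s ∧ B = {φ : V → Bool | ∀ v ∈ S, φ v = false}} := by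
  apply le_antisymm
  · refine iSup₂_le fun v hv => Measurable.comap_le ?_
    refine @measurable_to_bool _ (_) _ ?_
    have h1 : @MeasurableSet _ (MeasurableSpace.generateFrom
        {B | ∃ S : Finset V, ↑S ⊆ s ∧ B = {φ : V → Bool | ∀ v ∈ S, φ v = false}})
        {φ : V → Bool | φ v = false} :=
      MeasurableSpace.measurableSet_generateFrom ⟨{v}, by simpa using hv, by simp⟩
    have h2 : (fun φ : V → Bool => φ v) ⁻¹' {true} = {φ : V → Bool | φ v = false}ᶜ := by
      ext φ; simp
    rw [h2]
    exact h1.compl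
  · refine MeasurableSpace.generateFrom_le ?_
    rintro _ ⟨S, hS, rfl⟩
    exact measurableSet_forall_vacant s S hS

lemma isPiSystem_forall_vacant (s : Set V) : IsPiSystem
    {B | ∃ S : Finset V, ↑S ⊆ s ∧ B = {φ : V → Bool | ∀ v ∈ S, φ v = false}} := by
  classical
  rintro _ ⟨S, hS, rfl⟩ _ ⟨T, hT, rfl⟩ -
  refine ⟨S ∪ T, by simp [hS, hT], ?_⟩
  ext φ
  simp only [Set.mem_inter_iff, Set.mem_ofPred_eq, Finset.mem_union]
  exact ⟨fun h v hv => hv.elim (h.1 v) (h.2 v), fun h => ⟨fun v hv => h v (Or.inl hv),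
    fun v hv => h v (Or.inr hv)⟩⟩

/-- A simple chain is a Gibbs measure. -/
lemma IsSimple.isGibbs (hG : G.IsTree) {k : ℕ} (hreg : G.IsRegularOfDegree (k + 1))
    (hlam : 0 < lam) (hp0 : 0 < p) (hp1 : p < 1) (hpl : p = lam * (1 - p) ^ (k + 1))
    (hs : IsSimple G ν) (h : IsChain G (1 - p) ν) {π₀ : ℝ} (hπ : π₀ ≠ 0)
    (hvac : ∀ u, ∫ φ, vac u φ ∂ν = π₀) (hocc : ∀ u, ∫ φ, occ u φ ∂ν = p * π₀) :
    IsGibbs G lam ν := by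
  classical
  have := countable_of_isTree hG
  have := h.isProbabilityMeasure
  refine isGibbs_of_integral_occ_mul hlam h.isHardCore fun u B hB => ?_
  have hprod : ∀ S : Finset V, ↑S ⊆ ({u}ᶜ : Set V) →
      ∫ φ, occ u φ * ∏ v ∈ S, vac v φ ∂ν =
        lam * ∫ φ, vac u φ * (vacNbr G u φ * ∏ v ∈ S, vac v φ) ∂ν := by
    intro S hS
    have hSu : ∀ v ∈ S, u ≠ v := fun v hv huv => hS hv huv.symm
    -- `S` is sorted by the branch at `u` that contains each vertex, that is, by `parent G v u`, the
    -- neighbour of `u` towards `v`.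
    set f : V → (V → Bool) → ℝ := fun w φ => ∏ v ∈ S with v ∈ branch G u w, vac v φ with hf
    have hfib : ∀ φ, ∏ w ∈ G.neighborFinset u, f w φ = ∏ v ∈ S, vac v φ := by
      intro φ
      rw [← Finset.prod_fiberwise_of_maps_to (s := S) (t := G.neighborFinset u)
        (g := fun v => parent G v u)
        (fun v hv => (G.mem_neighborFinset u _).mpr (parent_spec hG (hSu v hv)).1)]
      refine Finset.prod_congr rfl fun w hw => Finset.prod_congr ?_ fun _ _ => rfl
      ext v
      simp only [Finset.mem_filter]
      refine and_congr_right fun hv => ⟨fun hvw => ?_, ?_⟩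
      · exact parent_eq hG ((G.mem_neighborFinset u w).mp hw) hvw
      · rintro rfl
        exact (parent_spec hG (hSu v hv)).2
    have key := hs.integral_occ_mul_prod hG h hp0.ne' hπ hvac hocc u f
      (fun w => IsBddOn.prod _ fun v hv => isBddOn_spin (Finset.mem_filter.mp hv).2 false)
      (G.neighborFinset u) subset_rfl
    simp only [Finset.prod_mul_distrib, hfib] at key
    rw [G.card_neighborFinset_eq_degree, hreg.degree_eq u] at key
    have hq : (1 - p) ^ (k + 1) ≠ 0 := pow_ne_zero _ (by linarith)
    refine mul_left_cancel₀ hq (key.trans ?_)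
    -- The equation for `p` supplies λ(1 - p)^(k+1), whose power matches the k + 1 branches at `u`.
    nth_rw 1 [hpl]
    simp only [vacNbr]
    ring
  set A : Set (V → Bool) := {φ | φ u = true} with hA
  set A' : Set (V → Bool) := {φ | ∀ v ∈ insert u (G.neighborFinset u), φ v = false} with hA'
  have hAm : MeasurableSet A := measurableSet_spin u true
  have hA'm : MeasurableSet A' := by
    have := measurableSet_forall_vacant Set.univ (insert u (G.neighborFinset u))
      (Set.subset_univ _)
    exact cylinderEvents_le_pi _ this
  have e1 : ∀ B, MeasurableSet B → ∫ φ, occ u φ * B.indicator (fun _ => 1) φ ∂ν =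
      (ν.restrict A).real B := by
    intro B hB
    rw [measureReal_restrict_apply hB, ← integral_indicator_one (hB.inter hAm)]
    congr 1
    funext φ
    have h3 : occ u φ = A.indicator (fun _ => 1) φ := congrFun (spin_eq_indicator u true) φ
    rw [h3]
    by_cases h1 : φ ∈ B <;> by_cases h2 : φ ∈ A <;> simp [h1, h2]
  have e2 : ∀ B, MeasurableSet B →
      ∫ φ, vac u φ * (vacNbr G u φ * B.indicator (fun _ => 1) φ) ∂ν =
        (ν.restrict A').real B := by
    intro B hB
    rw [measureReal_restrict_apply hB, ← integral_indicator_one (hB.inter hA'm)]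
    congr 1
    funext φ
    have h3 := congrFun (prod_vac_eq_indicator (insert u (G.neighborFinset u))) φ
    rw [Finset.prod_insert (by simp)] at h3
    rw [← mul_assoc, vacNbr, h3, ← hA']
    by_cases h1 : φ ∈ B <;> by_cases h2 : φ ∈ A' <;> simp [h1, h2]
  have hm : cylinderEvents (X := fun _ : V => Bool) {u}ᶜ ≤ MeasurableSpace.pi :=
    cylinderEvents_le_pi
  -- Two finite measures on the σ-algebra off `u` agree because they agree on the π-system of events
  -- that a finite set is vacant; the empty set gives the total mass.
  have htrim : (ν.restrict A).trim hm = (ENNReal.ofReal lam • ν.restrict A').trim hm := by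
    have hgen : ∀ S : Finset V, ↑S ⊆ ({u}ᶜ : Set V) →
        (ν.restrict A).trim hm {φ | ∀ v ∈ S, φ v = false} =
          (ENNReal.ofReal lam • ν.restrict A').trim hm {φ | ∀ v ∈ S, φ v = false} := by
      intro S hS
      have hZ := measurableSet_forall_vacant _ S hS
      rw [trim_measurableSet_eq hm hZ, trim_measurableSet_eq hm hZ, Measure.smul_apply,
        smul_eq_mul]
      have h1 := hprod S hS
      have h2 : ∀ φ : V → Bool, ∏ v ∈ S, vac v φ =
          {φ : V → Bool | ∀ v ∈ S, φ v = false}.indicator (fun _ => (1 : ℝ)) φ :=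
        fun φ => congrFun (prod_vac_eq_indicator S) φ
      simp only [h2] at h1
      rw [e1 _ (hm _ hZ), e2 _ (hm _ hZ)] at h1
      rw [← ENNReal.toReal_eq_toReal_iff' (measure_ne_top _ _)
        (ENNReal.mul_ne_top ENNReal.ofReal_ne_top (measure_ne_top _ _)), ENNReal.toReal_mul,
        ENNReal.toReal_ofReal hlam.le]
      exact h1
    have : IsFiniteMeasure ((ν.restrict A).trim hm) := isFiniteMeasure_trim hm
    refine ext_of_generate_finite _ (cylinderEvents_eq_generateFrom _)
      (isPiSystem_forall_vacant _) ?_ ?_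
    · rintro _ ⟨S, hS, rfl⟩
      exact hgen S hS
    · have := hgen ∅ (by simp)
      simpa using this
  rw [e1 B (hm _ hB), e2 B (hm _ hB)]
  have := congrArg (fun m => @DFunLike.coe _ _ _ _ m B) htrim
  simp only [trim_measurableSet_eq hm hB, Measure.smul_apply, smul_eq_mul] at this
  rw [Measure.real, this, ENNReal.toReal_mul, ENNReal.toReal_ofReal hlam.le]
  rfl

end GibbsOfChain

/-! ### Construction of the chain from independent trials -/

section Existence

variable {V : Type*} {G : SimpleGraph V} {p : ℝ}

/-- The law of a Boolean variable that is `true` with probability `r`. -/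
noncomputable def bern (r : ℝ) : Measure Bool :=
  ENNReal.ofReal (1 - r) • Measure.dirac false + ENNReal.ofReal r • Measure.dirac true

lemma isProbabilityMeasure_bern {r : ℝ} (h0 : 0 ≤ r) (h1 : r ≤ 1) :
    IsProbabilityMeasure (bern r) := by
  refine ⟨?_⟩
  simp [bern, ← ENNReal.ofReal_add (sub_nonneg.mpr h1) h0]

lemma bern_true (r : ℝ) : bern r {true} = ENNReal.ofReal r := by
  simp [bern]

/-- The configuration of the chain with root `o` that is built from independent trials `U`: a vertex
is occupied if its trial succeeds and its parent is vacant. -/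
noncomputable def chainConfig (G : SimpleGraph V) (o : V) (U : V → Bool) : V → Bool :=
  treeRec G o (U o) fun v b => U v && !b

lemma chainConfig_root (o : V) (U : V → Bool) : chainConfig G o U o = U o := treeRec_root _ _ _

lemma chainConfig_of_ne (hG : G.IsTree) {o v : V} (h : v ≠ o) (U : V → Bool) :
    chainConfig G o U v = (U v && !chainConfig G o U (parent G o v)) :=
  treeRec_of_ne hG _ _ h

lemma parent_mem_branch (hG : G.IsTree) {o u w v : V} (huw : G.Adj u w) (ho : o ∉ branch G u w)
    (hv : v ∈ branch G u w) : v ≠ o ∧ (parent G o v = u ∨ parent G o v ∈ branch G u w) := by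
  have hvo : v ≠ o := by rintro rfl; exact ho hv
  refine ⟨hvo, or_iff_not_imp_left.mpr fun h => ?_⟩
  exact mem_branch_of_adj hG huw (parent_spec hG hvo).1 h hv

lemma parent_notMem_branch (hG : G.IsTree) {o u w v : V} (huw : G.Adj u w)
    (ho : o ∉ branch G u w) (hv : v ∉ branch G u w) (hvo : v ≠ o) :
    parent G o v ∉ branch G u w := by
  intro hp
  obtain ⟨hadj, hob⟩ := parent_spec hG hvo
  by_cases hvu : v = u
  · subst hvu
    have := eq_of_mem_branch hG hadj huw (mem_branch_right hadj) hp
    exact ho (this ▸ hob)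
  · exact hv (mem_branch_of_adj hG huw hadj.symm hvu hp)

lemma measurable_chainConfig_compl (hG : G.IsTree) {o u w : V} (huw : G.Adj u w)
    (ho : o ∉ branch G u w) : Measurable[cylinderEvents (X := fun _ : V => Bool) (branch G u w)ᶜ,
      cylinderEvents (X := fun _ : V => Bool) (branch G u w)ᶜ] (chainConfig G o) := by
  refine measurable_cylinderEvents_iff.mpr fun v => ?_
  refine parent_induction hG o (P := fun v => v ∈ (branch G u w)ᶜ →
    Measurable[cylinderEvents (X := fun _ : V => Bool) (branch G u w)ᶜ]
      fun U => chainConfig G o U v) ?_ ?_ v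
  · intro h
    simp only [chainConfig_root]
    exact measurable_cylinderEvent_apply h
  · intro v hv ih hvb
    simp only [chainConfig_of_ne hG hv]
    have h1 := ih (parent_notMem_branch hG huw ho hvb hv)
    have h2 : Measurable[cylinderEvents (X := fun _ : V => Bool) (branch G u w)ᶜ]
      fun U : V → Bool => U v := measurable_cylinderEvent_apply hvb
    exact (measurable_of_countable fun b : Bool × Bool => b.1 && !b.2).comp (h2.prodMk h1)

lemma measurable_chainConfig (hG : G.IsTree) (o : V) : Measurable (chainConfig G o) := by
  refine measurable_pi_lambda _ fun v => ?_
  refine parent_induction hG o (P := fun v => Measurable fun U => chainConfig G o U v) ?_ ?_ v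
  · simp only [chainConfig_root]
    exact measurable_pi_apply o
  · intro v hv ih
    simp only [chainConfig_of_ne hG hv]
    exact (measurable_of_countable fun b : Bool × Bool => b.1 && !b.2).comp
      ((measurable_pi_apply v).prodMk ih)

/-- On a branch away from the root, the chain is a function of the value at the vertex before the
branch and the trials on the branch. -/
lemma exists_measurable_eq_chainConfig (hG : G.IsTree) {o u w : V} (huw : G.Adj u w)
    (ho : o ∉ branch G u w) (a : Bool) : ∃ Ψ : (V → Bool) → (V → Bool),
      Measurable[cylinderEvents (X := fun _ : V => Bool) (branch G u w),
        cylinderEvents (X := fun _ : V => Bool) (branch G u w)] Ψ ∧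
      ∀ U, chainConfig G o U u = a → ∀ v ∈ branch G u w, Ψ U v = chainConfig G o U v := by
  classical
  set Ψ : (V → Bool) → (V → Bool) := fun U =>
    treeRec G o a fun v b => if v = u then a else U v && !b with hΨ
  have hu : ∀ U, Ψ U u = a := by
    intro U
    by_cases h : u = o
    · rw [h]; exact treeRec_root _ _ _
    · simp only [hΨ]
      rw [treeRec_of_ne hG _ _ h, if_pos rfl]
  have hv : ∀ U v, v ≠ o → v ≠ u → Ψ U v = (U v && !Ψ U (parent G o v)) := by
    intro U v h1 h2
    simp only [hΨ]
    rw [treeRec_of_ne hG _ _ h1, if_neg h2]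
  refine ⟨Ψ, measurable_cylinderEvents_iff.mpr fun v => ?_, fun U hU v => ?_⟩
  · refine parent_induction hG o (P := fun v => v ∈ branch G u w →
      Measurable[cylinderEvents (X := fun _ : V => Bool) (branch G u w)] fun U => Ψ U v) ?_ ?_ v
    · exact fun h => absurd h ho
    · intro v hvo ih hvb
      simp only [hv _ v hvo (ne_of_mem_branch hvb)]
      have h2 : Measurable[cylinderEvents (X := fun _ : V => Bool) (branch G u w)]
        fun U : V → Bool => U v := measurable_cylinderEvent_apply hvb
      have h1 : Measurable[cylinderEvents (X := fun _ : V => Bool) (branch G u w)]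
          fun U : V → Bool => Ψ U (parent G o v) := by
        rcases (parent_mem_branch hG huw ho hvb).2 with h | h
        · simp only [h, hu]
          exact @measurable_const _ _ _ (_) _
        · exact ih h
      exact (measurable_of_countable fun b : Bool × Bool => b.1 && !b.2).comp (h2.prodMk h1)
  · refine parent_induction hG o (P := fun v => v ∈ branch G u w →
      Ψ U v = chainConfig G o U v) ?_ ?_ v
    · exact fun h => absurd h ho
    · intro v hvo ih hvb
      rw [hv _ v hvo (ne_of_mem_branch hvb), chainConfig_of_ne hG hvo]
      rcases (parent_mem_branch hG huw ho hvb).2 with h | h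
      · rw [h, hu, hU]
      · rw [ih h]

/-- The law of independent trials that succeed with probability `p / (1 + p)` at the root and `p`
elsewhere. -/
noncomputable def trialLaw (o : V) (p : ℝ) : Measure (V → Bool) :=
  open Classical in Measure.infinitePi fun v => bern (if v = o then p / (1 + p) else p)

/-- The law of the hard-core chain with root `o`. -/
noncomputable def chainLaw (G : SimpleGraph V) (o : V) (p : ℝ) : Measure (V → Bool) :=
  (trialLaw o p).map (chainConfig G o)

lemma isProbabilityMeasure_bern_ite (o : V) (hp0 : 0 < p) (hp1 : p < 1) (v : V) :
    IsProbabilityMeasure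
      (open Classical in bern (if v = o then p / (1 + p) else p)) := by
  split_ifs
  · exact isProbabilityMeasure_bern (by positivity) ((div_le_one (by positivity)).mpr (by linarith))
  · exact isProbabilityMeasure_bern hp0.le hp1.le

lemma isProbabilityMeasure_trialLaw (o : V) (hp0 : 0 < p) (hp1 : p < 1) :
    IsProbabilityMeasure (trialLaw o p) := by
  have := isProbabilityMeasure_bern_ite o hp0 hp1
  unfold trialLaw
  infer_instance

lemma indep_trialLaw (o : V) (hp0 : 0 < p) (hp1 : p < 1) (s : Set V) :
    Indep (cylinderEvents (X := fun _ : V => Bool) s)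
      (cylinderEvents (X := fun _ : V => Bool) sᶜ) (trialLaw o p) := by
  classical
  have := isProbabilityMeasure_bern_ite o hp0 hp1
  have h := iIndepFun_infinitePi (P := fun v => bern (if v = o then p / (1 + p) else p))
    (X := fun _ b => b) (fun _ => measurable_id)
  exact indep_iSup_of_disjoint (fun v => (measurable_pi_apply v).comap_le) h disjoint_compl_right

lemma trialLaw_apply (o : V) (hp0 : 0 < p) (hp1 : p < 1) (v : V) :
    (trialLaw o p).real {U | U v = true} =
      open Classical in if v = o then p / (1 + p) else p := by
  classical
  have := isProbabilityMeasure_bern_ite o hp0 hp1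
  have h := Measure.infinitePi_map_eval (fun v => bern (if v = o then p / (1 + p) else p)) v
  have h2 : trialLaw o p {U | U v = true} = bern (if v = o then p / (1 + p) else p) {true} := by
    rw [← h, Measure.map_apply (measurable_pi_apply v) (measurableSet_singleton true)]
    rfl
  rw [Measure.real, h2, bern_true, ENNReal.toReal_ofReal]
  split_ifs
  · positivity
  · exact hp0.le

lemma isProbabilityMeasure_chainLaw (hG : G.IsTree) (o : V) (hp0 : 0 < p) (hp1 : p < 1) :
    IsProbabilityMeasure (chainLaw G o p) :=
  have := isProbabilityMeasure_trialLaw o hp0 hp1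
  Measure.isProbabilityMeasure_map (measurable_chainConfig hG o).aemeasurable

lemma isHardCore_chainLaw (hG : G.IsTree) (o : V) : IsHardCore G (chainLaw G o p) := by
  intro u w huw
  rw [chainLaw, ae_map_iff (measurable_chainConfig hG o).aemeasurable]
  · refine ae_of_all _ fun U => ?_
    rcases eq_parent_or_eq_parent hG o huw with ⟨h, rfl⟩ | ⟨h, rfl⟩
    · have := chainConfig_of_ne hG h U
      cases h1 : chainConfig G o U (parent G o u) <;> simp [spin, h1, this]
    · have := chainConfig_of_ne hG h U
      cases h1 : chainConfig G o U (parent G o w) <;> simp [spin, h1, this]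
  · have hs : ∀ v : V, IsBddOn Set.univ (occ v) := fun v => isBddOn_spin (Set.mem_univ v) true
    exact measurableSet_eq_fun ((hs u).mul (hs w)).measurable measurable_const

/-- The trial at a vertex is independent of the value at its parent, and the root probability is
stationary: p(1 - p/(1 + p)) = p/(1 + p). -/
lemma integral_occ_chainLaw (hG : G.IsTree) (o : V) (hp0 : 0 < p) (hp1 : p < 1) (v : V) :
    ∫ φ, occ v φ ∂(chainLaw G o p) = p / (1 + p) := by
  classical
  have := isProbabilityMeasure_trialLaw o hp0 hp1
  have hm := measurable_chainConfig hG o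
  have hreal : ∀ v, ∫ φ, occ v φ ∂(chainLaw G o p) =
      (trialLaw o p).real {U | chainConfig G o U v = true} := by
    intro v
    rw [integral_spin, chainLaw, map_measureReal_apply hm (measurableSet_spin v true)]
    rfl
  refine parent_induction hG o (P := fun v => ∫ φ, occ v φ ∂(chainLaw G o p) = p / (1 + p))
    ?_ ?_ v
  · rw [hreal]
    simp only [chainConfig_root]
    rw [trialLaw_apply o hp0 hp1, if_pos rfl]
  · intro v hv ih
    rw [hreal] at ih ⊢
    set u := parent G o v with hu
    have hadj : G.Adj u v := (parent_spec hG hv).1.symm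
    have ho : o ∉ branch G u v := by
      have := (parent_spec hG hv).2
      rw [← compl_branch hG hadj] at this
      exact this
    have hmv := measurable_cylinderEvents_iff.mp (measurable_chainConfig_compl hG hadj ho)
      (notMem_branch_left u v)
    have hset : {U | chainConfig G o U v = true} =
        {U : V → Bool | U v = true} ∩ {U | chainConfig G o U u = true}ᶜ := by
      ext U
      simp [chainConfig_of_ne hG hv, ← hu]
    have hind := (Indep_iff _ _ _).mp (indep_trialLaw o hp0 hp1 (branch G u v))
      {U : V → Bool | U v = true} {U | chainConfig G o U u = true}ᶜ
      (measurable_cylinderEvent_apply (X := fun _ : V => Bool) (mem_branch_right hadj)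
        (measurableSet_singleton true))
      (hmv (measurableSet_singleton true)).compl
    have hmu : MeasurableSet {U | chainConfig G o U u = true} :=
      hm (measurableSet_spin u true)
    rw [hset, Measure.real, hind, ENNReal.toReal_mul, ← Measure.real, ← Measure.real,
      probReal_compl_eq_one_sub hmu, ih, trialLaw_apply o hp0 hp1, if_neg hv]
    field_simp
    ring

/-- Once the value at `u` is fixed, the branch is a function of the trials inside it, while
everything else is a function of the trials outside it. -/
lemma indep_branch_chainLaw (hG : G.IsTree) {o : V} (hp0 : 0 < p) (hp1 : p < 1) {u w : V}
    (huw : G.Adj u w) (ho : o ∉ branch G u w) (a : Bool)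
    (ha : chainLaw G o p {φ | φ u = a} ≠ 0) :
    Indep (cylinderEvents (X := fun _ : V => Bool) (branch G u w))
      (cylinderEvents (X := fun _ : V => Bool) (branch G u w)ᶜ)
      ((chainLaw G o p)[|{φ | φ u = a}]) := by
  have := isProbabilityMeasure_chainLaw hG o hp0 hp1
  have hm := measurable_chainConfig hG o
  set A : Set (V → Bool) := {φ | φ u = a} with hA
  have hAm : MeasurableSet A := measurableSet_spin u a
  have hAc : MeasurableSet[cylinderEvents (X := fun _ : V => Bool) (branch G u w)ᶜ] A :=
    measurable_cylinderEvent_apply (X := fun _ : V => Bool) (Δ := (branch G u w)ᶜ)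
      (notMem_branch_left u w) (measurableSet_singleton a)
  obtain ⟨Ψ, hΨm, hΨ⟩ := exists_measurable_eq_chainConfig hG huw ho a
  have key : ∀ t₁ t₂ : Set (V → Bool),
      MeasurableSet[cylinderEvents (X := fun _ : V => Bool) (branch G u w)] t₁ →
      MeasurableSet[cylinderEvents (X := fun _ : V => Bool) (branch G u w)ᶜ] t₂ →
      chainLaw G o p (A ∩ (t₁ ∩ t₂)) = trialLaw o p (Ψ ⁻¹' t₁) * chainLaw G o p (A ∩ t₂) := by
    intro t₁ t₂ h₁ h₂
    have hm₁ := cylinderEvents_le_pi _ h₁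
    have hm₂ := cylinderEvents_le_pi _ h₂
    rw [chainLaw, Measure.map_apply hm (hAm.inter (hm₁.inter hm₂)),
      Measure.map_apply hm (hAm.inter hm₂)]
    have hset : chainConfig G o ⁻¹' (A ∩ (t₁ ∩ t₂)) = Ψ ⁻¹' t₁ ∩ chainConfig G o ⁻¹' (A ∩ t₂) := by
      ext U
      simp only [Set.mem_preimage, Set.mem_inter_iff]
      have : chainConfig G o U ∈ A → (chainConfig G o U ∈ t₁ ↔ Ψ U ∈ t₁) := by
        intro hUA
        have h3 := (isBddOn_indicator h₁).dependsOn (x := Ψ U) (y := chainConfig G o U)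
          (hΨ U hUA)
        by_cases h4 : Ψ U ∈ t₁ <;> by_cases h5 : chainConfig G o U ∈ t₁ <;> simp_all
      tauto
    rw [hset]
    exact (Indep_iff _ _ _).mp (indep_trialLaw o hp0 hp1 (branch G u w)) _ _ (hΨm h₁)
      (measurable_chainConfig_compl hG huw ho (hAc.inter h₂))
  rw [Indep_iff]
  intro t₁ t₂ h₁ h₂
  have e1 := key t₁ t₂ h₁ h₂
  have e2 := key t₁ Set.univ h₁ MeasurableSet.univ
  simp only [Set.inter_univ] at e2
  rw [cond_apply hAm, cond_apply hAm, cond_apply hAm, e1, e2]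
  rw [show (chainLaw G o p A)⁻¹ * (trialLaw o p (Ψ ⁻¹' t₁) * chainLaw G o p A) =
    trialLaw o p (Ψ ⁻¹' t₁) * ((chainLaw G o p A)⁻¹ * chainLaw G o p A) by ring,
    ENNReal.inv_mul_cancel ha (measure_ne_top _ _)]
  ring

/-- At most one component at `u` contains the root. The others are split off one by one, each being
independent of everything outside it, so the root component never has to be split off itself. -/
lemma isSimple_chainLaw (hG : G.IsTree) (o : V) (hp0 : 0 < p) (hp1 : p < 1) :
    IsSimple G (chainLaw G o p) := by
  classical
  have := isProbabilityMeasure_chainLaw hG o hp0 hp1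
  intro u a ha
  have : IsProbabilityMeasure ((chainLaw G o p)[|{φ | φ u = a}]) :=
    cond_isProbabilityMeasure ha
  set P := (chainLaw G o p)[|{φ | φ u = a}] with hP
  have hind : ∀ C : G.ComponentCompl {u}, o ∉ C.supp →
      Indep (cylinderEvents (X := fun _ : V => Bool) C.supp)
        (cylinderEvents (X := fun _ : V => Bool) C.suppᶜ) P := by
    intro C hC
    obtain ⟨w, huw, hw⟩ := exists_supp_eq_branch hG C
    rw [hw] at hC ⊢
    exact indep_branch_chainLaw hG hp0 hp1 huw hC a ha
  have hsub : ∀ C D : G.ComponentCompl {u}, C ≠ D → C.supp ⊆ D.suppᶜ := fun C D h =>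
    Set.disjoint_left.mp (SimpleGraph.ComponentCompl.pairwise_disjoint h)
  -- The event `t` stands for the factor of the component containing the root, or for the whole
  -- space.
  have key : ∀ (S : Finset (G.ComponentCompl {u})) (f : G.ComponentCompl {u} → Set (V → Bool))
      (t : Set (V → Bool)),
      (∀ C ∈ S, MeasurableSet[cylinderEvents (X := fun _ : V => Bool) C.supp] (f C)) →
      (∀ C ∈ S, o ∉ C.supp) →
      (∀ C ∈ S, MeasurableSet[cylinderEvents (X := fun _ : V => Bool) C.suppᶜ] t) →
      P (t ∩ ⋂ C ∈ S, f C) = P t * ∏ C ∈ S, P (f C) := by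
    intro S f t
    induction S using Finset.induction_on with
    | empty => simp
    | insert C S hCS ih =>
      intro hf ho ht
      have hC := Finset.mem_insert_self C S
      have hS : ∀ {D}, D ∈ S → D ∈ insert C S := fun h => Finset.mem_insert_of_mem h
      have hset : t ∩ ⋂ D ∈ insert C S, f D = f C ∩ (t ∩ ⋂ D ∈ S, f D) := by
        rw [Finset.set_biInter_insert, Set.inter_left_comm]
      have hmeas : MeasurableSet[cylinderEvents (X := fun _ : V => Bool) C.suppᶜ]
          (t ∩ ⋂ D ∈ S, f D) :=
        (ht C hC).inter (Finset.measurableSet_biInter _ fun D hD =>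
          cylinderEvents_mono (hsub D C fun h => hCS (h ▸ hD)) _ (hf D (hS hD)))
      rw [hset, (Indep_iff _ _ _).mp (hind C (ho C hC)) _ _ (hf C hC) hmeas,
        ih (fun D hD => hf D (hS hD)) (fun D hD => ho D (hS hD)) (fun D hD => ht D (hS hD)),
        Finset.prod_insert hCS]
      ring
  rw [iIndep_iff]
  intro S f hf
  by_cases hex : ∃ C ∈ S, o ∈ C.supp
  · obtain ⟨C, hC, hoC⟩ := hex
    have hne : ∀ D ∈ S.erase C, D ≠ C := fun D hD => Finset.ne_of_mem_erase hD
    have h := key (S.erase C) f (f C) (fun D hD => hf D (Finset.mem_of_mem_erase hD))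
      (fun D hD hoD => hsub D C (hne D hD) hoD hoC)
      (fun D hD => cylinderEvents_mono (hsub C D (hne D hD).symm) _ (hf C hC))
    rw [Finset.mul_prod_erase S (fun C => P (f C)) hC] at h
    rw [← h, ← Finset.set_biInter_insert, Finset.insert_erase hC]
  · push Not at hex
    have h := key S f Set.univ hf hex (fun _ _ => MeasurableSet.univ)
    simpa using h

variable [G.LocallyFinite]

/-- The construction singles out a root, yet the law is invariant, since the chain property does not
mention the root and determines the law. -/
lemma exists_isSimpleInvariantGibbs (hG : G.IsTree) {k : ℕ} (hreg : G.IsRegularOfDegree (k + 1))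
    {lam : ℝ} (hlam : 0 < lam) : ∃ μ, IsSimpleInvariantGibbs G lam μ := by
  obtain ⟨p, hp0, hp1, hpl⟩ := exists_eq_mul_one_sub_pow k hlam
  obtain ⟨o⟩ := hG.connected.nonempty
  obtain ⟨z, hz⟩ : ∃ z, G.Adj o z := by
    have : 0 < G.degree o := by rw [hreg.degree_eq o]; omega
    exact (G.degree_pos_iff_exists_adj o).mp this
  have := isProbabilityMeasure_chainLaw hG o hp0 hp1
  have hs := isSimple_chainLaw hG o hp0 hp1
  have hocc : ∀ u, ∫ φ, occ u φ ∂(chainLaw G o p) = p * (1 + p)⁻¹ := fun u => by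
    rw [integral_occ_chainLaw hG o hp0 hp1, div_eq_mul_inv]
  have hvac : ∀ u, ∫ φ, vac u φ ∂(chainLaw G o p) = (1 + p)⁻¹ := fun u => by
    rw [integral_vac, hocc]
    field_simp
    ring
  have hπ : (1 + p)⁻¹ ≠ 0 := by positivity
  have hchain : IsChain G (1 - p) (chainLaw G o p) := by
    refine hs.isChain hG (isHardCore_chainLaw hG o) hvac hπ ?_
    field_simp
    ring
  exact ⟨_, hs.isGibbs hG hreg hlam hp0 hp1 hpl hchain hπ hvac hocc, hs,
    hchain.isInvariant hG (by linarith) (by linarith) hz⟩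

lemma existsUnique_isSimpleInvariantGibbs (hG : G.IsTree) {k : ℕ}
    (hreg : G.IsRegularOfDegree (k + 1)) {lam : ℝ} (hlam : 0 < lam) :
    ∃! μ, IsSimpleInvariantGibbs G lam μ := by
  obtain ⟨μ, hμ⟩ := exists_isSimpleInvariantGibbs hG hreg hlam
  refine ⟨μ, hμ, fun ν hν => ?_⟩
  obtain ⟨p, hp0, hp1, hpl⟩ := exists_eq_mul_one_sub_pow k hlam
  obtain ⟨o⟩ := hG.connected.nonempty
  obtain ⟨z, hz⟩ : ∃ z, G.Adj o z := by
    have : 0 < G.degree o := by rw [hreg.degree_eq o]; omega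
    exact (G.degree_pos_iff_exists_adj o).mp this
  exact (hν.isChain hG hreg hlam hp1.le hpl).eq hG (by linarith) (by linarith)
    (hμ.isChain hG hreg hlam hp1.le hpl) hz

end Existence

end HardCore

theorem mainTheorem3 (k : ℕ) (hk : 1 ≤ k) {V : Type*} (G : SimpleGraph V) [G.LocallyFinite]
    (hG : G.IsTree) (hreg : G.IsRegularOfDegree (k + 1)) :
    (∀ lam : ℝ, 0 < lam → lam ≤ Real.exp 1 - 1 →
      (∃! μ : Measure (V → Bool), HardCore.IsSimpleInvariantGibbs G lam μ) ∧
      ∀ μ : Measure (V → Bool), HardCore.IsSimpleInvariantGibbs G lam μ →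
        HardCore.IsExtremalGibbs G lam μ) ∧
    ((∃! μ : Measure (V → Bool), HardCore.IsSimpleInvariantGibbs G 1 μ) ∧
      ∀ μ : Measure (V → Bool), HardCore.IsSimpleInvariantGibbs G 1 μ →
        HardCore.IsExtremalGibbs G 1 μ) := by
  have main : ∀ lam : ℝ, 0 < lam → lam ≤ Real.exp 1 - 1 →
      (∃! μ : Measure (V → Bool), HardCore.IsSimpleInvariantGibbs G lam μ) ∧
      ∀ μ : Measure (V → Bool), HardCore.IsSimpleInvariantGibbs G lam μ →
        HardCore.IsExtremalGibbs G lam μ := fun lam hlam hlam' =>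
    ⟨HardCore.existsUnique_isSimpleInvariantGibbs hG hreg hlam,
      fun _ hμ => hμ.isExtremalGibbs hG hk hreg hlam hlam'⟩
  refine ⟨main, main 1 one_pos ?_⟩
  have := Real.exp_one_gt_d9
  linarith
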